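/- All graphs are finite and undirected, and all surfaces are orientable. For a graph $G$ with $c(G)$ components let $\beta(G)=|E(G)|-|V(G)|+c(G)$ be its Betti number, and let $\gamma(G)$ be its (minimum) genus, i.e. the least $k$ such that $G$ embeds in the orientable surface of genus $k$; combinatorially (Heffter--Edmonds), $\gamma(G)$ is the least $k$ such that some rotation system of $G$ (a cyclic ordering of the edge-ends at each vertex) has $F$ faces with $|V(G)|-|E(G)|+F=2c(G)-2k$ (an isolated vertex counting as one face). Duke's conjecture states that $\beta(G)\ge 4\gamma(G)$ for all graphs $G$. Let $H_3$ be the graph obtained from $K_{2,3}$ by attaching a pendant vertex (a *free node*) to each of its three $2$-valent vertices. Given a graph $G$ and a family $T$ of $n$ triples of distinct $2$-valent vertices of $G$, the *scaffolded graph* $H(G,T)$ is formed from $G$ and $n$ disjoint copies of $H_3$ by identifying, for each $i$, the three free nodes of the $i$-th copy one-to-one with the vertices of the $i$-th triple. Let $G_6$ be the cycle $C_{15}$ with its vertices labelled, in cyclic order, $a_0,\dots,a_4,b_0,\dots,b_4,c_0,\dots,c_4$, let $t_i=\{a_i,b_i,c_i\}$, $T_5=\{t_0,t_1,t_2,t_3,t_4\}$,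 and $M_6=H(G_6,T_5)$. Let $G_5$ be obtained from $G_6$ by adding an edge between $a_0$ and $b_0$, let $T_4=\{t_1,t_2,t_3,t_4\}$, and $M_5=H(G_5,T_4)$. **Corollary.** The graph $M_6$ is cubic, has $40$ vertices, and $\gamma(M_6)=6$, $\beta(M_6)=21$. Moreover $\gamma(M_5)=5$ and $\beta(M_5)=18$. Hence both $M_6$ and $M_5$ are counterexamples to Duke's conjecture: $\beta(M_6)<4\gamma(M_6)$ and $\beta(M_5)<4\gamma(M_5)$. -/

import Mathlib

/-- A rotation system on a simple graph `G`: a permutation of the darts (edge-ends) of `G` that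
fixes the initial vertex of every dart and permutes the darts leaving any given vertex in a single
cycle. By the Heffter-Edmonds correspondence these are, up to equivalence, the cellular embeddings
of `G` in closed orientable surfaces (one connected surface for each component of `G`). -/
structure RotationSystem {V : Type*} (G : SimpleGraph V) where
  next : Equiv.Perm G.Dart
  next_fst : ∀ d : G.Dart, (next d).fst = d.fst
  isCyclic : ∀ d e : G.Dart, d.fst = e.fst → next.SameCycle d e

/-- The reversal of darts, as a permutation. -/
def dartReversal {V : Type*} (G : SimpleGraph V) : Equiv.Perm G.Dart :=
  Function.Involutive.toPerm SimpleGraph.Dart.symm SimpleGraph.Dart.symm_involutive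

/-- Face tracing: traverse a dart `d`, then leave its end vertex along the dart that follows
the reverse of `d` in the rotation there. The faces are the cycles of this permutation. -/
def RotationSystem.faceTracing {V : Type*} {G : SimpleGraph V} (R : RotationSystem G) :
    Equiv.Perm G.Dart :=
  R.next * dartReversal G

/-- The number of faces of an embedding. An isolated vertex carries no dart, and lies on a sphere
of its own, with one face. -/
noncomputable def RotationSystem.numFaces {V : Type*} {G : SimpleGraph V}
    (R : RotationSystem G) : ℕ :=
  Nat.card (Quotient (Equiv.Perm.SameCycle.setoid R.faceTracing)) +
    Nat.card {v : V // ∀ w, ¬ G.Adj v w}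

/-- The finite graph `G` has a cellular embedding of (total) genus `k`: for some rotation system
the Euler equation `|V| - |E| + |F| = 2c - 2k` holds, `c` being the number of components. -/
def HasEmbeddingOfGenus {V : Type*} (G : SimpleGraph V) (k : ℕ) : Prop :=
  ∃ R : RotationSystem G,
    (Nat.card V : ℤ) - (Nat.card G.edgeSet : ℤ) + (R.numFaces : ℤ) =
      2 * (Nat.card G.ConnectedComponent : ℤ) - 2 * (k : ℤ)

/-- The (minimum, orientable) genus of a finite graph. -/
noncomputable def graphGenus {V : Type*} (G : SimpleGraph V) : ℕ :=
  sInf {k : ℕ | HasEmbeddingOfGenus G k}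

/-- The Betti number `|E| - |V| + c` of a finite graph. -/
noncomputable def bettiNumber {V : Type*} (G : SimpleGraph V) : ℤ :=
  (Nat.card G.edgeSet : ℤ) - (Nat.card V : ℤ) + (Nat.card G.ConnectedComponent : ℤ)

/-- The inequality `β(G) ≥ 4 γ(G)` that Duke conjectured for all finite graphs `G`. -/
def SatisfiesDuke {V : Type*} (G : SimpleGraph V) : Prop :=
  bettiNumber G ≥ 4 * (graphGenus G : ℤ)

/-- The vertices of `H₃`: three free nodes, and the two sides of a `K_{2,3}`. -/
inductive H3Vertex where
  | free (j : Fin 3)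
  | mid (j : Fin 3)
  | pole (p : Fin 2)

/-- The graph `H₃`: the complete bipartite graph between `pole 0, pole 1` and
`mid 0, mid 1, mid 2`, with a pendant vertex `free j` attached to each 2-valent vertex `mid j`. -/
def H3 : SimpleGraph H3Vertex :=
  SimpleGraph.fromRel fun x y =>
    match x, y with
    | .pole _, .mid _ => True
    | .free i, .mid j => i = j
    | _, _ => False

/-- The vertices of a scaffolded graph: those of `G`, and for each copy of `H₃`, indexed by `ι`,
the five vertices of that copy that are not free nodes (`inl` for `mid`, `inr` for `pole`). -/
abbrev ScaffoldVertex (V ι : Type*) := V ⊕ ι × (Fin 3 ⊕ Fin 2)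

/-- The map of the `i`-th copy of `H₃` into the scaffolded graph, which identifies its free nodes
with the vertices of the triple `t i`. -/
def scaffoldMap {V ι : Type*} (t : ι → Fin 3 ↪ V) (i : ι) : H3Vertex → ScaffoldVertex V ι
  | .free j => Sum.inl (t i j)
  | .mid j => Sum.inr (i, Sum.inl j)
  | .pole p => Sum.inr (i, Sum.inr p)

/-- The scaffolded graph `H(G, T)` for the family `T` of triples `t i` of distinct vertices of `G`:
its edges are those of `G` and those of the attached copies of `H₃`. The order of the vertices
within a triple is immaterial, as `H₃` has all the permutations of its free nodes as symmetries. -/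
def scaffoldedGraph {V ι : Type*} (G : SimpleGraph V) (t : ι → Fin 3 ↪ V) :
    SimpleGraph (ScaffoldVertex V ι) :=
  SimpleGraph.fromRel fun x y =>
    (∃ u v, G.Adj u v ∧ x = Sum.inl u ∧ y = Sum.inl v) ∨
      ∃ i p q, H3.Adj p q ∧ x = scaffoldMap t i p ∧ y = scaffoldMap t i q

/-- The triple `{a_i, b_i, c_i}` of vertices of the cycle graph on `Fin 15`, whose vertices
`0, 1, …, 14` are named `a_0, …, a_4, b_0, …, b_4, c_0, …, c_4` in this (cyclic) order. -/
def cycleTriple (i : Fin 5) : Fin 3 ↪ Fin 15 where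
  toFun j := ⟨5 * j.val + i.val, by omega⟩
  inj' j k h := by
    have h' := congrArg Fin.val h
    simp only at h'
    omega

/-- `G₆` is the cycle `C₁₅`. -/
def graphG6 : SimpleGraph (Fin 15) := SimpleGraph.cycleGraph 15

/-- `G₅` is `G₆` with an added edge between `a_0` and `b_0`. -/
def graphG5 : SimpleGraph (Fin 15) :=
  graphG6 ⊔ SimpleGraph.edge (cycleTriple 0 0) (cycleTriple 0 1)

/-- `M₆ = H(G₆, T₅)`, with the five triples `{a_i, b_i, c_i}`, `0 ≤ i ≤ 4`. -/
def graphM6 : SimpleGraph (ScaffoldVertex (Fin 15) (Fin 5)) :=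
  scaffoldedGraph graphG6 cycleTriple

/-- `M₅ = H(G₅, T₄)`, with the four triples `{a_i, b_i, c_i}`, `1 ≤ i ≤ 4`. -/
def graphM5 : SimpleGraph (ScaffoldVertex (Fin 15) (Fin 4)) :=
  scaffoldedGraph graphG5 fun i => cycleTriple i.succ

open Equiv

/-- The number of cycles of a permutation, fixed points included. -/
noncomputable def cycleCount {α : Type*} (σ : Perm α) : ℕ :=
  Nat.card (Quotient (Perm.SameCycle.setoid σ))

section CycleCount

variable {α β : Type*}

theorem mk_eq_mk_iff_sameCycle {σ : Perm α} {a b : α} :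
    (Quotient.mk (Perm.SameCycle.setoid σ) a = Quotient.mk (Perm.SameCycle.setoid σ) b) ↔
      σ.SameCycle a b :=
  Quotient.eq

/-- An equivalence relation that relates every point to its image contains the cycle relation. -/
theorem Equiv.Perm.SameCycle.of_equivalence {σ : Perm α} {r : α → α → Prop} (hr : Equivalence r)
    (h : ∀ a, r a (σ a)) {a b : α} (hab : σ.SameCycle a b) : r a b := by
  obtain ⟨n, rfl⟩ := hab
  have hnat : ∀ (n : ℕ) a, r a ((σ ^ n) a) := by
    intro n
    induction n with
    | zero => exact fun a => hr.refl a
    | succ n ih =>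
      intro a
      rw [pow_succ', Perm.mul_apply]
      exact hr.trans (ih a) (h _)
  obtain ⟨n, rfl | rfl⟩ := n.eq_nat_or_neg
  · simpa using hnat n a
  · have := hr.symm (hnat n ((σ ^ (-(n : ℤ))) a))
    simpa using this

theorem Equiv.Perm.SameCycle.mem_of_closed [Finite α] {σ : Perm α} {S : Set α}
    (hS : ∀ a ∈ S, σ a ∈ S) {a b : α} (hab : σ.SameCycle a b) (ha : a ∈ S) : b ∈ S := by
  obtain ⟨n, -, rfl⟩ := hab.exists_pow_eq'
  clear hab
  induction n with
  | zero => simpa using ha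
  | succ n ih =>
    rw [pow_succ', Perm.mul_apply]
    exact hS _ ih

theorem cycleCount_mul_swap_le [Finite α] [DecidableEq α] (σ : Perm α) (x y : α) :
    cycleCount (σ * swap x y) ≤ cycleCount σ + 1 := by
  classical
  set σ' := σ * swap x y with hσ'
  let f : Quotient (Perm.SameCycle.setoid σ') → Option (Quotient (Perm.SameCycle.setoid σ)) :=
    fun q => if q = Quotient.mk _ y then none else some (Quotient.mk _ q.out)
  have key : ∀ a b, σ.SameCycle a b → σ'.SameCycle a b ∨
      (σ'.SameCycle a x ∨ σ'.SameCycle a y) ∧ (σ'.SameCycle b x ∨ σ'.SameCycle b y) := by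
    intro a b hab
    refine hab.of_equivalence (r := fun a b => σ'.SameCycle a b ∨
      (σ'.SameCycle a x ∨ σ'.SameCycle a y) ∧ (σ'.SameCycle b x ∨ σ'.SameCycle b y))
      ⟨fun a => Or.inl (Perm.SameCycle.refl _ _), ?_, ?_⟩ ?_
    · rintro a b (h | h)
      · exact Or.inl h.symm
      · exact Or.inr h.symm
    · rintro a b c (h | ⟨h1, h2⟩) (h' | ⟨h1', h2'⟩)
      · exact Or.inl (h.trans h')
      · exact Or.inr ⟨h1'.imp h.trans h.trans, h2'⟩
      · exact Or.inr ⟨h1, h2.imp h'.symm.trans h'.symm.trans⟩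
      · exact Or.inr ⟨h1, h2'⟩
    · intro a
      have hx : σ' x = σ y := by simp [hσ']
      have hy : σ' y = σ x := by simp [hσ']
      by_cases hax : a = x
      · subst hax
        refine Or.inr ⟨Or.inl (Perm.SameCycle.refl _ _), Or.inr ?_⟩
        rw [← hy]
        exact Perm.sameCycle_apply_left.2 (Perm.SameCycle.refl _ _)
      · by_cases hay : a = y
        · subst hay
          refine Or.inr ⟨Or.inr (Perm.SameCycle.refl _ _), Or.inl ?_⟩
          rw [← hx]
          exact Perm.sameCycle_apply_left.2 (Perm.SameCycle.refl _ _)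
        · left
          have : σ' a = σ a := by simp [hσ', swap_apply_of_ne_of_ne hax hay]
          rw [← this]
          exact Perm.sameCycle_apply_right.2 (Perm.SameCycle.refl _ _)
  have hf : Function.Injective f := by
    intro p q hpq
    simp only [f] at hpq
    split_ifs at hpq with hp hq hq
    · rw [hp, hq]
    · rw [Option.some.injEq, mk_eq_mk_iff_sameCycle] at hpq
      have hp' : ¬ σ'.SameCycle p.out y := by
        rwa [← mk_eq_mk_iff_sameCycle, Quotient.out_eq]
      have hq' : ¬ σ'.SameCycle q.out y := by
        rwa [← mk_eq_mk_iff_sameCycle, Quotient.out_eq]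
      rw [← Quotient.out_eq p, ← Quotient.out_eq q, mk_eq_mk_iff_sameCycle]
      rcases key _ _ hpq with h | ⟨h1, h2⟩
      · exact h
      · exact (h1.resolve_right hp').trans (h2.resolve_right hq').symm
  have := Nat.card_le_card_of_injective f hf
  rwa [Finite.card_option] at this

theorem cycleCount_mul_swap_add_one_le [Finite α] [DecidableEq α] {σ : Perm α} {x y : α}
    (h : ¬ σ.SameCycle x y) : cycleCount (σ * swap x y) + 1 ≤ cycleCount σ := by
  set σ' := σ * swap x y with hσ'
  have hx : σ' x = σ y := by simp [hσ']
  have hy : σ' y = σ x := by simp [hσ']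
  have hne : ∀ a, a ≠ x → a ≠ y → σ' a = σ a := fun a h1 h2 => by
    simp [hσ', swap_apply_of_ne_of_ne h1 h2]
  -- following `σ` from `σ x` leads back to `x` without meeting `y`
  have hxy : σ'.SameCycle x y := by
    let S : Set α := {a | σ'.SameCycle a y ∧ σ.SameCycle a x}
    by_contra hcon
    have hS : ∀ a ∈ S, σ a ∈ S := by
      rintro a ⟨h1, h2⟩
      have hax : a ≠ x := by rintro rfl; exact hcon h1
      have hay : a ≠ y := by rintro rfl; exact h h2.symm
      refine ⟨?_, Perm.sameCycle_apply_left.2 h2⟩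
      rw [← hne a hax hay]
      exact Perm.sameCycle_apply_left.2 h1
    have h0 : σ x ∈ S := by
      refine ⟨?_, Perm.sameCycle_apply_left.2 (Perm.SameCycle.refl _ _)⟩
      rw [← hy]
      exact Perm.sameCycle_apply_left.2 (Perm.SameCycle.refl _ _)
    have : x ∈ S := Perm.SameCycle.mem_of_closed hS
      (Perm.sameCycle_apply_left.2 (Perm.SameCycle.refl σ x)) h0
    exact hcon this.1
  have key : ∀ a b, σ.SameCycle a b → σ'.SameCycle a b := by
    intro a b hab
    refine hab.of_equivalence (r := σ'.SameCycle) (Perm.SameCycle.equivalence σ') fun a => ?_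
    by_cases hax : a = x
    · subst hax
      rw [← hy]
      exact Perm.sameCycle_apply_right.2 hxy
    · by_cases hay : a = y
      · subst hay
        rw [← hx]
        exact Perm.sameCycle_apply_right.2 hxy.symm
      · rw [← hne a hax hay]
        exact Perm.sameCycle_apply_right.2 (Perm.SameCycle.refl _ _)
  let f : Quotient (Perm.SameCycle.setoid σ) → Quotient (Perm.SameCycle.setoid σ') :=
    Quotient.map' id key
  have hf : Function.Surjective f := by
    rintro ⟨a⟩
    exact ⟨Quotient.mk _ a, rfl⟩
  have hle := Nat.card_le_card_of_surjective f hf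
  refine lt_of_le_of_ne hle fun heq => h ?_
  have hinj := ((Nat.bijective_iff_surjective_and_card f).2 ⟨hf, heq.symm⟩).1
  have := @hinj (Quotient.mk _ x) (Quotient.mk _ y) (mk_eq_mk_iff_sameCycle.2 hxy)
  exact mk_eq_mk_iff_sameCycle.1 this

/-- Inserting a fixed point `x` into another cycle. -/
theorem cycleCount_mul_swap_of_fixed [Finite α] [DecidableEq α] {σ : Perm α} {x y : α}
    (hx : σ x = x) (hxy : x ≠ y) : cycleCount (σ * swap x y) + 1 ≤ cycleCount σ :=
  cycleCount_mul_swap_add_one_le fun h =>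
    hxy (Perm.SameCycle.mem_of_closed (S := {x}) (by simpa using hx) h rfl).symm

theorem cycleCount_mul_prod_swap_le [Finite α] [DecidableEq α] (σ : Perm α) (l : List (α × α)) :
    cycleCount (σ * (l.map fun p => swap p.1 p.2).prod) ≤ cycleCount σ + l.length := by
  induction l generalizing σ with
  | nil => simp
  | cons p l ih =>
    rw [List.map_cons, List.prod_cons, ← mul_assoc, List.length_cons]
    have := ih (σ * swap p.1 p.2)
    have := cycleCount_mul_swap_le σ p.1 p.2
    omega

theorem cycleCount_congr {σ : Perm α} {τ : Perm β} (e : α ≃ β) (h : ∀ a, e (σ a) = τ (e a)) :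
    cycleCount σ = cycleCount τ := by
  have hτ : ∀ b, e.symm (τ b) = σ (e.symm b) := fun b => by
    rw [Equiv.symm_apply_eq, h, Equiv.apply_symm_apply]
  have h1 : ∀ a b, σ.SameCycle a b → τ.SameCycle (e a) (e b) := by
    intro a b hab
    refine hab.of_equivalence (r := fun a b => τ.SameCycle (e a) (e b))
      ((Perm.SameCycle.equivalence τ).comap e) fun a => ?_
    rw [h]
    exact Perm.sameCycle_apply_right.2 (Perm.SameCycle.refl _ _)
  have h2 : ∀ a b, τ.SameCycle a b → σ.SameCycle (e.symm a) (e.symm b) := by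
    intro a b hab
    refine hab.of_equivalence (r := fun a b => σ.SameCycle (e.symm a) (e.symm b))
      ((Perm.SameCycle.equivalence σ).comap e.symm) fun a => ?_
    rw [hτ]
    exact Perm.sameCycle_apply_right.2 (Perm.SameCycle.refl _ _)
  exact Nat.card_congr (Quotient.congr e fun a b =>
    ⟨h1 a b, fun hab => show σ.SameCycle a b by simpa using h2 _ _ hab⟩)

/-- A surjective function that is constant along the cycles bounds their number from below. -/
theorem card_le_cycleCount [Finite α] {σ : Perm α} (f : α → β) (hf : Function.Surjective f)
    (h : ∀ a, f (σ a) = f a) : Nat.card β ≤ cycleCount σ := by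
  refine Nat.card_le_card_of_surjective (Quotient.lift f fun a b hab => ?_) fun b => ?_
  · exact Perm.SameCycle.of_equivalence (r := fun a b => f a = f b)
      (eq_equivalence.comap f) (fun a => (h a).symm) hab
  · obtain ⟨a, rfl⟩ := hf b
    exact ⟨Quotient.mk _ a, rfl⟩

/-- A family that meets every cycle bounds their number from above. -/
theorem cycleCount_le_card [Finite β] {σ : Perm α} (f : β → α)
    (h : ∀ a, ∃ b, σ.SameCycle (f b) a) : cycleCount σ ≤ Nat.card β := by
  refine Nat.card_le_card_of_surjective (fun b => Quotient.mk _ (f b)) ?_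
  rintro ⟨a⟩
  obtain ⟨b, hb⟩ := h a
  exact ⟨b, mk_eq_mk_iff_sameCycle.2 hb⟩

end CycleCount

/-- The darts of an attached copy of `H₃`: `inl j` leads from the `j`-th free node to `mid j`, and
`inr (w, k)` is the `k`-th dart at the vertex `w`, where the darts at `mid j` lead to the free node
and to the two poles, and those at a pole lead to the three mids. -/
abbrev GadgetDart := Fin 3 ⊕ (Fin 3 ⊕ Fin 2) × Fin 3

/-- The reversal of the darts of a copy of `H₃`. -/
def gadgetReversal : GadgetDart → GadgetDart
  | .inl j => .inr (.inl j, 0)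
  | .inr (.inl j, k) => ![.inl j, .inr (.inr 0, j), .inr (.inr 1, j)] k
  | .inr (.inr p, j) => .inr (.inl j, p.succ)

theorem gadgetReversal_involutive : Function.Involutive gadgetReversal := by
  unfold Function.Involutive
  decide

section Scaffold

variable {V ι : Type*} {G : SimpleGraph V} (t : ι → Fin 3 ↪ V)

/-- The initial vertex of a dart of a scaffolded graph. -/
def scaffoldSource : G.Dart ⊕ ι × GadgetDart → ScaffoldVertex V ι
  | .inl d => .inl d.fst
  | .inr (i, .inl j) => .inl (t i j)
  | .inr (i, .inr (w, _)) => .inr (i, w)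

/-- The reversal of the darts of a scaffolded graph. -/
def scaffoldReversal : G.Dart ⊕ ι × GadgetDart → G.Dart ⊕ ι × GadgetDart :=
  Sum.map SimpleGraph.Dart.symm (Prod.map id gadgetReversal)

theorem scaffoldReversal_involutive :
    Function.Involutive (scaffoldReversal (G := G) (ι := ι)) := by
  rintro (d | ⟨i, γ⟩)
  · simp [scaffoldReversal]
  · simp [scaffoldReversal, gadgetReversal_involutive γ]

theorem H3_adj_mid_pole (j : Fin 3) (p : Fin 2) : H3.Adj (.mid j) (.pole p) := by
  simp [H3]

theorem H3_adj_free_mid (j : Fin 3) : H3.Adj (.free j) (.mid j) := by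
  simp [H3]

theorem scaffoldedGraph_adj_inl {u v : V} (h : G.Adj u v) :
    (scaffoldedGraph G t).Adj (.inl u) (.inl v) := by
  rw [scaffoldedGraph, SimpleGraph.fromRel_adj]
  exact ⟨fun e => h.ne (Sum.inl_injective e), Or.inl (Or.inl ⟨u, v, h, rfl, rfl⟩)⟩

theorem scaffoldMap_ne (i : ι) {p q : H3Vertex} (h : p ≠ q) :
    scaffoldMap t i p ≠ scaffoldMap t i q := by
  cases p <;> cases q <;> simp_all [scaffoldMap]

theorem scaffoldedGraph_adj_map (i : ι) {p q : H3Vertex} (h : H3.Adj p q) :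
    (scaffoldedGraph G t).Adj (scaffoldMap t i p) (scaffoldMap t i q) := by
  rw [scaffoldedGraph, SimpleGraph.fromRel_adj]
  exact ⟨scaffoldMap_ne t i h.ne, Or.inl (Or.inr ⟨i, p, q, h, rfl, rfl⟩)⟩

theorem scaffoldSource_adj (ω : G.Dart ⊕ ι × GadgetDart) :
    (scaffoldedGraph G t).Adj (scaffoldSource t ω) (scaffoldSource t (scaffoldReversal ω)) := by
  rcases ω with d | ⟨i, j | ⟨j | p, k⟩⟩
  · exact scaffoldedGraph_adj_inl t d.adj
  · exact scaffoldedGraph_adj_map t i (H3_adj_free_mid j)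
  · fin_cases k
    · exact scaffoldedGraph_adj_map t i (H3_adj_free_mid j).symm
    · exact scaffoldedGraph_adj_map t i (H3_adj_mid_pole j 0)
    · exact scaffoldedGraph_adj_map t i (H3_adj_mid_pole j 1)
  · exact scaffoldedGraph_adj_map t i (H3_adj_mid_pole k p).symm

/-- The dart of the scaffolded graph with a given name. -/
def scaffoldDart (ω : G.Dart ⊕ ι × GadgetDart) : (scaffoldedGraph G t).Dart :=
  ⟨(scaffoldSource t ω, scaffoldSource t (scaffoldReversal ω)), scaffoldSource_adj t ω⟩

theorem scaffoldDart_symm (ω : G.Dart ⊕ ι × GadgetDart) :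
    (scaffoldDart t ω).symm = scaffoldDart t (scaffoldReversal ω) := by
  apply SimpleGraph.Dart.ext
  apply Prod.ext
  · rfl
  · change scaffoldSource t ω = scaffoldSource t (scaffoldReversal (scaffoldReversal ω))
    rw [scaffoldReversal_involutive ω]

theorem H3_adj_cases {p q : H3Vertex} (h : H3.Adj p q) :
    (∃ j s, p = .mid j ∧ q = .pole s) ∨ (∃ j s, p = .pole s ∧ q = .mid j) ∨
      (∃ j, p = .free j ∧ q = .mid j) ∨ ∃ j, p = .mid j ∧ q = .free j := by
  rw [H3, SimpleGraph.fromRel_adj] at h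
  cases p <;> cases q <;> simp_all

theorem exists_scaffoldDart_of_adj {x y : ScaffoldVertex V ι}
    (h : (scaffoldedGraph G t).Adj x y) :
    ∃ ω : G.Dart ⊕ ι × GadgetDart,
      scaffoldSource t ω = x ∧ scaffoldSource t (scaffoldReversal ω) = y := by
  have key : ∀ x y, ((∃ u v, G.Adj u v ∧ x = Sum.inl u ∧ y = Sum.inl v) ∨
      ∃ i p q, H3.Adj p q ∧ x = scaffoldMap t i p ∧ y = scaffoldMap t i q) →
      ∃ ω : G.Dart ⊕ ι × GadgetDart,
        scaffoldSource t ω = x ∧ scaffoldSource t (scaffoldReversal ω) = y := by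
    rintro x y (⟨u, v, huv, rfl, rfl⟩ | ⟨i, p, q, hpq, rfl, rfl⟩)
    · exact ⟨.inl ⟨(u, v), huv⟩, rfl, rfl⟩
    · obtain ⟨j, s, rfl, rfl⟩ | ⟨j, s, rfl, rfl⟩ | ⟨j, rfl, rfl⟩ | ⟨j, rfl, rfl⟩ :=
        H3_adj_cases hpq
      · refine ⟨.inr (i, .inr (.inl j, s.succ)), rfl, ?_⟩
        fin_cases s <;> rfl
      · exact ⟨.inr (i, .inr (.inr s, j)), rfl, rfl⟩
      · exact ⟨.inr (i, .inl j), rfl, rfl⟩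
      · exact ⟨.inr (i, .inr (.inl j, 0)), rfl, rfl⟩
  rw [scaffoldedGraph, SimpleGraph.fromRel_adj] at h
  rcases h.2 with h | h
  · exact key x y h
  · obtain ⟨ω, h1, h2⟩ := key y x h
    exact ⟨scaffoldReversal ω, h2, by rwa [scaffoldReversal_involutive ω]⟩

theorem scaffoldDart_bijective : Function.Bijective (scaffoldDart (G := G) t) := by
  constructor
  · intro ω ω' h
    have h1 : scaffoldSource t ω = scaffoldSource t ω' :=
      congrArg (fun d : (scaffoldedGraph G t).Dart => d.fst) h
    have h2 : scaffoldSource t (scaffoldReversal ω) = scaffoldSource t (scaffoldReversal ω') :=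
      congrArg (fun d : (scaffoldedGraph G t).Dart => d.snd) h
    clear h
    rcases ω with d | ⟨i, j | ⟨j | p, k⟩⟩ <;> rcases ω' with d' | ⟨i', j' | ⟨j' | p', k'⟩⟩ <;>
      simp [scaffoldSource, scaffoldReversal, gadgetReversal] at h1 h2
    · exact congrArg Sum.inl (SimpleGraph.Dart.ext _ _ (Prod.ext h1 h2))
    · rw [h2.1, h2.2]
    · obtain ⟨rfl, rfl⟩ := h1
      fin_cases k <;> fin_cases k' <;> simp at h2 ⊢
    · obtain ⟨rfl, rfl⟩ := h1
      rw [h2.2]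
  · intro d
    obtain ⟨ω, h1, h2⟩ := exists_scaffoldDart_of_adj t d.adj
    exact ⟨ω, SimpleGraph.Dart.ext _ _ (Prod.ext h1 h2)⟩

/-- The darts of a scaffolded graph. -/
noncomputable def scaffoldDartEquiv : G.Dart ⊕ ι × GadgetDart ≃ (scaffoldedGraph G t).Dart :=
  Equiv.ofBijective _ (scaffoldDart_bijective t)

end Scaffold

/-- The rotations at the mids and poles of a copy of `H₃`, in the direction given by `b`. -/
def gadgetRotation (b : Fin 3 ⊕ Fin 2 → Bool) : Perm GadgetDart :=
  Equiv.sumCongr 1 (Equiv.prodCongrRight fun w => Equiv.addRight (if b w then 1 else 2))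

/-- The reversal of the darts of a copy of `H₃`, as a permutation. -/
def gadgetReversalPerm : Perm GadgetDart :=
  gadgetReversal_involutive.toPerm

/-- The ends other than the `o`-th. -/
def lowEnd : Fin 3 → Fin 3 := ![1, 0, 0]

/-- The ends other than the `o`-th. -/
def highEnd : Fin 3 → Fin 3 := ![2, 2, 1]

/-- The transposition of the two free nodes other than the `o`-th. -/
def chordSwap (o : Fin 3) : Perm GadgetDart :=
  swap (.inl (lowEnd o)) (.inl (highEnd o))

instance decidableMemGadgetDart (x : GadgetDart) (l : List GadgetDart) : Decidable (x ∈ l) :=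
  @List.instDecidableMemOfLawfulBEq _ instBEqOfDecidableEq _ x l

/-- The last point before `x` on its cycle that does not lie in `removed`. -/
def lastBefore (σ : Perm GadgetDart) (removed : List GadgetDart) : ℕ → GadgetDart → GadgetDart
  | 0, x => σ.symm x
  | n + 1, x => if σ.symm x ∈ removed then lastBefore σ removed n (σ.symm x) else σ.symm x

/-- The insertions that build up the cycles of `σ` from those that remain when the points of the
list are removed in turn. -/
def insertionList (σ : Perm GadgetDart) :
    List GadgetDart → List GadgetDart → List (GadgetDart × GadgetDart)
  | _, [] => []
  | removed, x :: l =>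
    if lastBefore σ removed 15 x = x then insertionList σ (x :: removed) l
    else insertionList σ (x :: removed) l ++ [(x, lastBefore σ removed 15 x)]

/-- The darts that leave the mids and poles. -/
def innerDarts : List GadgetDart :=
  ([.inl 0, .inl 1, .inl 2, .inr 0, .inr 1] : List (Fin 3 ⊕ Fin 2)).flatMap fun w =>
    [.inr (w, 0), .inr (w, 1), .inr (w, 2)]

/-- Each pair of the list inserts a new point after some other point. -/
def IsInsertionList {Γ : Type*} (l : List (Γ × Γ)) : Prop :=
  (∀ p ∈ l, p.1 ≠ p.2) ∧ l.Pairwise fun p q => q.1 ≠ p.1 ∧ q.1 ≠ p.2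

instance {Γ : Type*} [DecidableEq Γ] (l : List (Γ × Γ)) : Decidable (IsInsertionList l) := by
  unfold IsInsertionList
  infer_instance

/-- The possible pairs of free nodes by whose transposition the action of a copy of `H₃` differs
from that of a single chord. -/
def correctionLists : List (List (GadgetDart × GadgetDart)) :=
  [[], [(.inl 0, .inl 1)], [(.inl 0, .inl 2)], [(.inl 1, .inl 2)]]

theorem gadget_decomposition_aux (b₀ b₁ b₂ b₃ b₄ : Bool) :
    let σ := gadgetRotation (Sum.elim ![b₀, b₁, b₂] ![b₃, b₄]) * gadgetReversalPerm
    let l := insertionList σ [] innerDarts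
    IsInsertionList l ∧ (∀ p ∈ l, p.1 ∈ innerDarts) ∧
    ∃ o : Fin 3, ∃ l₀ ∈ correctionLists, l.length = 14 + l₀.length ∧
      ∀ γ, σ γ = (chordSwap o * ((l₀ ++ l).map fun p => swap p.1 p.2).prod) γ := by
  revert b₀ b₁ b₂ b₃ b₄
  decide +kernel

theorem gadget_decomposition (b : Fin 3 ⊕ Fin 2 → Bool) :
    ∃ (o : Fin 3) (l₀ l : List (GadgetDart × GadgetDart)), IsInsertionList l ∧
      (∀ p ∈ l, ∃ z, p.1 = .inr z) ∧ (∀ p ∈ l₀, ∃ j k, p = (.inl j, .inl k)) ∧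
      l.length = 14 + l₀.length ∧
      gadgetRotation b * gadgetReversalPerm = chordSwap o *
        (l₀.map fun p => swap p.1 p.2).prod * (l.map fun p => swap p.1 p.2).prod := by
  have hb : b = Sum.elim ![b (.inl 0), b (.inl 1), b (.inl 2)] ![b (.inr 0), b (.inr 1)] := by
    funext w
    rcases w with j | p
    · fin_cases j <;> rfl
    · fin_cases p <;> rfl
  rw [hb]
  obtain ⟨h1, h2, o, l₀, hl₀, h3, h4⟩ := gadget_decomposition_aux (b (.inl 0)) (b (.inl 1))
    (b (.inl 2)) (b (.inr 0)) (b (.inr 1))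
  refine ⟨o, l₀, _, h1, fun p hp => ?_, fun p hp => ?_, h3, ?_⟩
  · have := h2 p hp
    simp only [innerDarts, List.flatMap_cons, List.flatMap_nil, List.cons_append,
      List.nil_append, List.mem_cons, List.not_mem_nil, or_false] at this
    rcases this with h | h | h | h | h | h | h | h | h | h | h | h | h | h | h <;>
      exact ⟨_, h⟩
  · simp only [correctionLists, List.mem_cons, List.not_mem_nil, or_false] at hl₀
    rcases hl₀ with rfl | rfl | rfl | rfl <;> simp at hp <;> exact ⟨_, _, hp⟩
  · ext1 γ
    rw [h4 γ, List.map_append, List.prod_append, mul_assoc]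

section Insertion

variable {Γ Ω : Type*} [DecidableEq Γ] [DecidableEq Ω]

theorem cycleCount_insertions [Finite Ω] {H : Perm Γ → Perm Ω} {e : Γ → Ω}
    (he : Function.Injective e)
    (hmul : ∀ σ x y, H (σ * swap x y) = H σ * swap (e x) (e y)) {S : Set Γ}
    (hfix : ∀ σ, ∀ x ∈ S, σ x = x → H σ (e x) = e x) {l : List (Γ × Γ)} (hl : IsInsertionList l)
    (hS : ∀ p ∈ l, p.1 ∈ S) (σ : Perm Γ) (hσ : ∀ p ∈ l, σ p.1 = p.1) :
    cycleCount (H (σ * (l.map fun p => swap p.1 p.2).prod)) + l.length ≤ cycleCount (H σ) := by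
  induction l generalizing σ with
  | nil => simp
  | cons p l ih =>
    obtain ⟨h1, h2⟩ := hl
    rw [List.pairwise_cons] at h2
    have := ih ⟨fun q hq => h1 q (List.mem_cons_of_mem _ hq), h2.2⟩
      (fun q hq => hS q (List.mem_cons_of_mem _ hq)) (σ * swap p.1 p.2) fun q hq => by
        rw [Perm.mul_apply, swap_apply_of_ne_of_ne (h2.1 q hq).1 (h2.1 q hq).2]
        exact hσ q (List.mem_cons_of_mem _ hq)
    have h3 := cycleCount_mul_swap_of_fixed (y := e p.2)
      (hfix σ p.1 (hS p List.mem_cons_self) (hσ p List.mem_cons_self))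
      (he.ne (h1 p List.mem_cons_self))
    rw [← hmul] at h3
    rw [List.map_cons, List.prod_cons, ← mul_assoc, List.length_cons]
    omega

theorem map_mul_prod_swap {H : Perm Γ → Perm Ω} {e : Γ → Ω}
    (hmul : ∀ σ x y, H (σ * swap x y) = H σ * swap (e x) (e y)) (l : List (Γ × Γ)) (σ : Perm Γ) :
    H (σ * (l.map fun p => swap p.1 p.2).prod) =
      H σ * ((l.map (Prod.map e e)).map fun p => swap p.1 p.2).prod := by
  induction l generalizing σ with
  | nil => simp
  | cons p l ih =>
    simp only [List.map_cons, List.prod_cons, ← mul_assoc, Prod.map_fst, Prod.map_snd]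
    rw [ih, hmul]

end Insertion

/-- A copy of `H₃` acts on the faces as a chord with one additional face, or worse. -/
theorem exists_chordSwap (b : Fin 3 ⊕ Fin 2 → Bool) : ∃ o : Fin 3,
    ∀ {Ω : Type*} [Finite Ω] [DecidableEq Ω] {H : Perm GadgetDart → Perm Ω} {e : GadgetDart → Ω},
      Function.Injective e → (∀ σ x y, H (σ * swap x y) = H σ * swap (e x) (e y)) →
      (∀ σ z, σ (.inr z) = .inr z → H σ (e (.inr z)) = e (.inr z)) →
      cycleCount (H (gadgetRotation b * gadgetReversalPerm)) + 14 ≤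
        cycleCount (H (chordSwap o)) := by
  obtain ⟨o, l₀, l, hl, h1, h2, h3, h4⟩ := gadget_decomposition b
  refine ⟨o, fun {Ω} _ _ H e he hmul hfix => ?_⟩
  have h5 : ∀ z : (Fin 3 ⊕ Fin 2) × Fin 3,
      (chordSwap o * (l₀.map fun p => swap p.1 p.2).prod) (.inr z) = .inr z := by
    intro z
    have : (l₀.map fun p => swap p.1 p.2).prod (.inr z) = .inr z := by
      clear h3 h4
      induction l₀ with
      | nil => rfl
      | cons p l₀ ih =>
        obtain ⟨j, k, hp⟩ := h2 p List.mem_cons_self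
        rw [List.map_cons, List.prod_cons, Perm.mul_apply,
          ih fun q hq => h2 q (List.mem_cons_of_mem _ hq), hp]
        exact swap_apply_of_ne_of_ne (by simp) (by simp)
    rw [Perm.mul_apply, this]
    exact swap_apply_of_ne_of_ne (by simp) (by simp)
  have h6 := cycleCount_insertions he hmul (S := Set.range Sum.inr)
    (by rintro σ _ ⟨z, rfl⟩ h; exact hfix σ z h) hl
    (fun p hp => by obtain ⟨z, hz⟩ := h1 p hp; exact ⟨z, hz.symm⟩)
    (chordSwap o * (l₀.map fun p => swap p.1 p.2).prod)
    (fun p hp => by obtain ⟨z, hz⟩ := h1 p hp; rw [hz, h5])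
  rw [← h4, map_mul_prod_swap hmul] at h6
  have h7 := cycleCount_mul_prod_swap_le (H (chordSwap o)) (l₀.map (Prod.map e e))
  rw [List.length_map] at h7
  omega

section Action

variable {K ι : Type*}

/-- The action of permutations of the darts of the copies of `H₃`. -/
def gadgetAction (A : ι → Perm GadgetDart) : Perm (K ⊕ ι × GadgetDart) :=
  Equiv.sumCongr 1 (Equiv.prodCongrRight A)

@[simp]
theorem gadgetAction_inl (A : ι → Perm GadgetDart) (k : K) :
    gadgetAction A (Sum.inl k : K ⊕ ι × GadgetDart) = Sum.inl k := rfl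

@[simp]
theorem gadgetAction_inr (A : ι → Perm GadgetDart) (i : ι) (γ : GadgetDart) :
    gadgetAction A (Sum.inr (i, γ) : K ⊕ ι × GadgetDart) = Sum.inr (i, A i γ) := rfl

theorem gadgetAction_update_mul_swap [DecidableEq K] [DecidableEq ι] (A : ι → Perm GadgetDart)
    (i : ι) (σ : Perm GadgetDart) (x y : GadgetDart) :
    (gadgetAction (Function.update A i (σ * swap x y)) : Perm (K ⊕ ι × GadgetDart)) =
      gadgetAction (Function.update A i σ) * swap (.inr (i, x)) (.inr (i, y)) := by
  ext1 ω
  rcases ω with k | ⟨i', γ⟩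
  · simp [swap_apply_of_ne_of_ne]
  · by_cases h : i' = i
    · subst h
      rw [gadgetAction_inr, Function.update_self, Perm.mul_apply, Perm.mul_apply]
      have : swap (Sum.inr (i', x)) (Sum.inr (i', y)) (Sum.inr (i', γ) : K ⊕ ι × GadgetDart) =
          Sum.inr (i', swap x y γ) := by
        simp only [swap_apply_def, Sum.inr.injEq, Prod.mk.injEq, true_and]
        split_ifs <;> rfl
      rw [this, gadgetAction_inr, Function.update_self]
    · rw [Perm.mul_apply, swap_apply_of_ne_of_ne (by simp [h]) (by simp [h]), gadgetAction_inr,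
        gadgetAction_inr, Function.update_of_ne h, Function.update_of_ne h]

theorem cycleCount_gadgetAction [Finite K] [Fintype ι] [DecidableEq K] [DecidableEq ι]
    (b : ι → Fin 3 ⊕ Fin 2 → Bool) : ∃ o : ι → Fin 3, ∀ ρ : Perm (K ⊕ ι × GadgetDart),
      (∀ i z, ρ (.inr (i, .inr z)) = .inr (i, .inr z)) →
      cycleCount (ρ * gadgetAction fun i => gadgetRotation (b i) * gadgetReversalPerm) +
        14 * Fintype.card ι ≤ cycleCount (ρ * gadgetAction fun i => chordSwap (o i)) := by
  choose o ho using fun i => exists_chordSwap (b i)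
  refine ⟨o, fun ρ hρ => ?_⟩
  have key : ∀ S : Finset ι,
      cycleCount (ρ * gadgetAction fun i => gadgetRotation (b i) * gadgetReversalPerm) +
        14 * S.card ≤ cycleCount (ρ * gadgetAction fun i => if i ∈ S then chordSwap (o i) else
          gadgetRotation (b i) * gadgetReversalPerm) := by
    intro S
    induction S using Finset.induction_on with
    | empty => simp
    | insert i S hi ih =>
      set A : ι → Perm GadgetDart := fun i => if i ∈ S then chordSwap (o i) else
          gadgetRotation (b i) * gadgetReversalPerm with hA
      have h1 : (fun j => if j ∈ insert i S then chordSwap (o j) else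
          gadgetRotation (b j) * gadgetReversalPerm) = Function.update A i (chordSwap (o i)) := by
        funext j
        by_cases hj : j = i
        · subst hj; simp
        · simp [hA, hj]
      have h2 : A = Function.update A i (gadgetRotation (b i) * gadgetReversalPerm) := by
        funext j
        by_cases hj : j = i
        · subst hj; simp [hA, hi]
        · rw [Function.update_of_ne hj]
      have h3 := ho i (H := fun σ => ρ * gadgetAction (Function.update A i σ))
        (e := fun γ => (Sum.inr (i, γ) : K ⊕ ι × GadgetDart)) (fun x y h => by simpa using h)
        (fun σ x y => by
          rw [gadgetAction_update_mul_swap, mul_assoc])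
        (fun σ z h => by
          rw [Perm.mul_apply, gadgetAction_inr, Function.update_self, h, hρ])
      rw [h1, Finset.card_insert_of_notMem hi]
      rw [h2] at ih
      omega
  simpa using key Finset.univ

end Action

section Reduction

variable {V ι : Type*} {G : SimpleGraph V}

/-- The reversal of the darts of the base graph. -/
def baseReversal (G : SimpleGraph V) (ι : Type*) : Perm (G.Dart ⊕ ι × GadgetDart) :=
  Equiv.sumCongr (dartReversal G) 1

theorem eq_add_of_injective : ∀ f : Fin 3 → Fin 3, Function.Injective f → (∀ k, f k ≠ k) →
    ∃ b : Bool, ∀ k, f k = k + if b then 1 else 2 := by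
  unfold Function.Injective
  decide +kernel

/-- The faces of a scaffolded graph are at most those that arise when every copy of `H₃` is
replaced by a chord that joins two of the vertices of its triple, plus one for each copy. Here the
chords act as transpositions, and the `15` darts inside each copy remain as fixed points. -/
theorem exists_chords_of_rotationSystem (t : ι → Fin 3 ↪ V) [Finite V] [Fintype ι]
    (R : RotationSystem (scaffoldedGraph G t)) :
    ∃ (ν : Perm (G.Dart ⊕ ι × GadgetDart)) (o : ι → Fin 3),
      (∀ ω, scaffoldSource t (ν ω) = scaffoldSource t ω) ∧
      (∀ i z, ν (.inr (i, .inr z)) = .inr (i, .inr z)) ∧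
      (∀ ω ω', scaffoldSource t ω = scaffoldSource t ω' → ω ≠ ω' →
        (∀ i z, ω ≠ .inr (i, .inr z)) → ν ω ≠ ω) ∧
      cycleCount R.faceTracing + 14 * Fintype.card ι ≤
        cycleCount (ν * baseReversal G ι * gadgetAction fun i => chordSwap (o i)) := by
  classical
  have : Finite G.Dart := Finite.of_injective _ (SimpleGraph.Dart.toProd_injective (G := G))
  let e := scaffoldDartEquiv (G := G) t
  have he1 : ∀ ω, (e ω).fst = scaffoldSource t ω := fun _ => rfl
  have he2 : ∀ ω, (e ω).symm = e (scaffoldReversal ω) := scaffoldDart_symm t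
  let η : Perm (G.Dart ⊕ ι × GadgetDart) := (e.trans R.next).trans e.symm
  have hη : ∀ ω, e (η ω) = R.next (e ω) := fun ω => by simp [η]
  have hη1 : ∀ ω, scaffoldSource t (η ω) = scaffoldSource t ω := fun ω => by
    rw [← he1, hη, R.next_fst, he1]
  have hη2 : ∀ ω ω', scaffoldSource t ω = scaffoldSource t ω' → ω ≠ ω' → η ω ≠ ω := by
    intro ω ω' h hne hfix
    have h1 := R.isCyclic (e ω) (e ω') h
    have h2 : R.next (e ω) = e ω := by rw [← hη, hfix]
    obtain ⟨n, hn⟩ := h1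
    rw [Perm.zpow_apply_eq_self_of_apply_eq_self h2] at hn
    exact hne (e.injective hn)
  have hinner : ∀ i w, ∃ b : Bool, ∀ k, η (.inr (i, .inr (w, k))) =
      .inr (i, .inr (w, k + if b then 1 else 2)) := by
    intro i w
    have h1 : ∀ k, ∃ k', η (.inr (i, .inr (w, k))) = .inr (i, .inr (w, k')) := by
      intro k
      have := hη1 (.inr (i, .inr (w, k)))
      rcases h : η (.inr (i, .inr (w, k))) with d | ⟨i', j | ⟨w', k'⟩⟩ <;> rw [h] at this <;>
        simp [scaffoldSource] at this
      obtain ⟨rfl, rfl⟩ := this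
      exact ⟨k', rfl⟩
    choose f hf using h1
    obtain ⟨b, hb⟩ := eq_add_of_injective f
      (fun k k' h => by
        have := (hf k).trans ((congrArg (fun k => Sum.inr (i, Sum.inr (w, k))) h).trans
          (hf k').symm)
        simpa using η.injective this)
      (fun k h => by
        refine hη2 (.inr (i, .inr (w, k))) (.inr (i, .inr (w, k + 1))) rfl (by simp) ?_
        rw [hf, h])
    exact ⟨b, fun k => by rw [hf, hb]⟩
  choose b hb using hinner
  let N : Perm (G.Dart ⊕ ι × GadgetDart) := gadgetAction fun i => gadgetRotation (b i)
  let ν := η * N⁻¹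
  have hνN : ∀ ω, ν (N ω) = η ω := fun ω => by simp [ν]
  have hNinner : ∀ i w k, N (.inr (i, .inr (w, k))) = η (.inr (i, .inr (w, k))) := fun i w k => by
    rw [hb]; rfl
  have hν1 : ∀ i z, ν (.inr (i, .inr z)) = .inr (i, .inr z) := by
    rintro i z
    obtain ⟨ω, hω⟩ := N.surjective (.inr (i, .inr z))
    rcases ω with d | ⟨i', j | ⟨w, k⟩⟩
    · simp [N] at hω
    · simp [N, gadgetRotation] at hω
    · rw [← hω, hνN, hNinner]
  have hνd : ∀ d, ν (.inl d) = η (.inl d) := fun d => hνN (.inl d)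
  have hνj : ∀ i j, ν (.inr (i, .inl j)) = η (.inr (i, .inl j)) := fun i j =>
    hνN (.inr (i, .inl j))
  obtain ⟨o, ho⟩ := cycleCount_gadgetAction (K := G.Dart) b
  refine ⟨ν, o, ?_, hν1, ?_, ?_⟩
  · rintro (d | ⟨i, j | z⟩)
    · rw [hνd, hη1]
    · rw [hνj, hη1]
    · rw [hν1]
  · rintro (d | ⟨i, j | z⟩) ω' h hne hin
    · rw [hνd]; exact hη2 _ _ h hne
    · rw [hνj]; exact hη2 _ _ h hne
    · exact absurd rfl (hin i z)
  · have h1 : cycleCount R.faceTracing = cycleCount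
        (ν * baseReversal G ι *
          gadgetAction fun i => gadgetRotation (b i) * gadgetReversalPerm) := by
      refine (cycleCount_congr e fun ω => ?_).symm
      have h2 : R.faceTracing (e ω) = e (η (scaffoldReversal ω)) := by
        rw [hη, ← he2]; rfl
      rw [h2]
      congr 1
      rw [← hνN]
      rcases ω with d | ⟨i, γ⟩ <;> rfl
    rw [h1]
    exact ho (ν * baseReversal G ι) fun i z => hν1 i z

end Reduction

/-- The chords `k` and `l` cross: an end of `l` lies between the ends of `k`, another one beyond. -/
abbrev ChordsCross (k l : Fin 5) (a b : Fin 3) : Prop :=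
  cycleTriple k (lowEnd a) < cycleTriple l (lowEnd b) ∧
    cycleTriple l (lowEnd b) < cycleTriple k (highEnd a) ∧
    cycleTriple k (highEnd a) < cycleTriple l (highEnd b)

theorem exists_chordsCross_aux (a₀ a₁ a₂ a₃ a₄ : Fin 3) (b₀ b₁ b₂ b₃ b₄ : Bool) :
    ∃ k l : Fin 5, (![b₀, b₁, b₂, b₃, b₄] : Fin 5 → Bool) k = ![b₀, b₁, b₂, b₃, b₄] l ∧
      ChordsCross k l (![a₀, a₁, a₂, a₃, a₄] k) (![a₀, a₁, a₂, a₃, a₄] l) := by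
  revert a₀ a₁ a₂ a₃ a₄ b₀ b₁ b₂ b₃ b₄
  decide +kernel

theorem exists_chordsCross (o : Fin 5 → Fin 3) (b : Fin 5 → Bool) :
    ∃ k l : Fin 5, b k = b l ∧ ChordsCross k l (o k) (o l) := by
  have h := exists_chordsCross_aux (o 0) (o 1) (o 2) (o 3) (o 4) (b 0) (b 1) (b 2) (b 3) (b 4)
  have ho : ![o 0, o 1, o 2, o 3, o 4] = o := by
    funext i; fin_cases i <;> rfl
  have hb : ![b 0, b 1, b 2, b 3, b 4] = b := by
    funext i; fin_cases i <;> rfl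
  rwa [ho, hb] at h

theorem cycleTriple_injective : ∀ i i' j j', cycleTriple i j = cycleTriple i' j' →
    i = i' ∧ j = j' := by
  decide

/-- The faces of the cycle `C₁₅` with half-edges `X s` attached at its vertices: the darts `P s`
lead from `s` to `s + 1` and the darts `M s` from `s` to `s - 1`, and the half-edge at `s`, if
there is one, lies on the face of the forward or of the backward darts. -/
structure IsCircleSystem {Ω : Type*} (ρ : Perm Ω) (P M X : Fin 15 → Ω)
    (side : Fin 15 → Option Bool) : Prop where
  forward : ∀ s, ρ (P s) = if side (s + 1) = some true then X (s + 1) else P (s + 1)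
  backward : ∀ s, ρ (M (s + 1)) = if side s = some false then X s else M s
  attached_true : ∀ s, side s = some true → ρ (X s) = P s
  attached_false : ∀ s, side s = some false → ρ (X s) = M s
  forward_ne : ∀ r s, P r ≠ X s
  backward_ne : ∀ r s, M r ≠ X s
  injective : Function.Injective X

namespace IsCircleSystem

variable {Ω : Type*} {ρ : Perm Ω} {P M X : Fin 15 → Ω} {side : Fin 15 → Option Bool}

theorem not_sameCycle_of_sides [Finite Ω] (h : IsCircleSystem ρ P M X side) {s s' : Fin 15}
    (hs : side s = some true) (hs' : side s' = some false) : ¬ ρ.SameCycle (X s) (X s') := by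
  intro hc
  have := hc.mem_of_closed (S := {ω | (∃ r, ω = P r) ∨ ∃ r, side r = some true ∧ ω = X r})
    (by
      rintro ω (⟨r, rfl⟩ | ⟨r, hr, rfl⟩)
      · rw [h.forward]
        split_ifs with h1
        · exact Or.inr ⟨_, h1, rfl⟩
        · exact Or.inl ⟨_, rfl⟩
      · rw [h.attached_true r hr]
        exact Or.inl ⟨_, rfl⟩) (Or.inr ⟨s, hs, rfl⟩)
  rcases this with ⟨r, hr⟩ | ⟨r, hr, hr'⟩
  · exact h.forward_ne _ _ hr.symm
  · rw [← h.injective hr', hs'] at hr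
    simp at hr

theorem not_sameCycle_of_cross_true [Finite Ω] [DecidableEq Ω] (h : IsCircleSystem ρ P M X side)
    {s t s' t' : Fin 15} (h1 : s < t) (h2 : t < s') (h3 : s' < t') (hs : side s = some true)
    (hs' : side s' = some true) (ht : side t = some true) : ¬ (ρ * swap (X s) (X s')).SameCycle (X t) (X t') := by
  intro hc
  have := hc.mem_of_closed (S := {ω | (∃ r, s ≤ r ∧ r < s' ∧ ω = P r) ∨
    ∃ r, s < r ∧ r ≤ s' ∧ side r = some true ∧ ω = X r})
    (by
      rintro ω (⟨r, hr, hr', rfl⟩ | ⟨r, hr, hr', hr2, rfl⟩)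
      · have h4 : s < r + 1 ∧ r + 1 ≤ s' := by omega
        rw [Perm.mul_apply, swap_apply_of_ne_of_ne (h.forward_ne _ _) (h.forward_ne _ _),
          h.forward]
        split_ifs with h5
        · exact Or.inr ⟨_, h4.1, h4.2, h5, rfl⟩
        · refine Or.inl ⟨_, h4.1.le, ?_, rfl⟩
          refine lt_of_le_of_ne h4.2 fun h6 => h5 ?_
          rw [h6, hs']
      · by_cases h6 : r = s'
        · subst h6
          rw [Perm.mul_apply, swap_apply_right, h.attached_true s hs]
          exact Or.inl ⟨s, le_refl _, h1.trans h2, rfl⟩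
        · rw [Perm.mul_apply, swap_apply_of_ne_of_ne (h.injective.ne hr.ne')
            (h.injective.ne h6), h.attached_true r hr2]
          exact Or.inl ⟨r, hr.le, lt_of_le_of_ne hr' h6, rfl⟩)
    (Or.inr ⟨t, h1, h2.le, ht, rfl⟩)
  rcases this with ⟨r, -, -, hr⟩ | ⟨r, hr1, hr2, hr, hr'⟩
  · exact h.forward_ne _ _ hr.symm
  · rw [← h.injective hr'] at hr2
    exact absurd h3 (not_lt.2 hr2)

theorem not_sameCycle_of_cross_false [Finite Ω] [DecidableEq Ω] (h : IsCircleSystem ρ P M X side)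
    {s t s' t' : Fin 15} (h1 : s < t) (h2 : t < s') (h3 : s' < t') (hs : side s = some false)
    (hs' : side s' = some false) (ht : side t = some false) :
    ¬ (ρ * swap (X s) (X s')).SameCycle (X t) (X t') := by
  intro hc
  have := hc.mem_of_closed (S := {ω | (∃ r, s < r ∧ r ≤ s' ∧ ω = M r) ∨
    ∃ r, s ≤ r ∧ r < s' ∧ side r = some false ∧ ω = X r})
    (by
      rintro ω (⟨r, hr, hr', rfl⟩ | ⟨r, hr, hr', hr2, rfl⟩)
      · have h4 : s ≤ r - 1 ∧ r - 1 < s' := by omega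
        have h5 := h.backward (r - 1)
        rw [sub_add_cancel] at h5
        rw [Perm.mul_apply, swap_apply_of_ne_of_ne (h.backward_ne _ _) (h.backward_ne _ _), h5]
        split_ifs with h5
        · exact Or.inr ⟨_, h4.1, h4.2, h5, rfl⟩
        · refine Or.inl ⟨_, lt_of_le_of_ne h4.1 fun h6 => h5 ?_, h4.2.le, rfl⟩
          rw [← h6, hs]
      · by_cases h6 : r = s
        · subst h6
          rw [Perm.mul_apply, swap_apply_left, h.attached_false s' hs']
          exact Or.inl ⟨s', h1.trans h2, le_refl _, rfl⟩
        · rw [Perm.mul_apply, swap_apply_of_ne_of_ne (h.injective.ne h6)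
            (h.injective.ne hr'.ne), h.attached_false r hr2]
          exact Or.inl ⟨r, lt_of_le_of_ne hr (Ne.symm h6), hr'.le, rfl⟩)
    (Or.inr ⟨t, h1.le, h2, ht, rfl⟩)
  rcases this with ⟨r, -, -, hr⟩ | ⟨r, hr1, hr2, hr, hr'⟩
  · exact h.backward_ne _ _ hr.symm
  · rw [← h.injective hr'] at hr2
    exact absurd (hr2.trans h3) (lt_irrefl _)

theorem cycleCount_le (h : IsCircleSystem ρ P M X side) {κ : Type*} [Finite κ] (f : κ → Ω)
    (hf : ∀ ω, (∃ s, ω = P s) ∨ (∃ s, ω = M s) ∨ (∃ s, side s ≠ none ∧ ω = X s) ∨ ∃ k, ω = f k) :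
    cycleCount ρ ≤ 2 + Nat.card κ := by
  have hP : ∀ s, ρ.SameCycle (P 0) (P s) := by
    intro s
    induction s using Fin.induction with
    | zero => exact Perm.SameCycle.refl _ _
    | succ s ih =>
      refine ih.trans ?_
      rw [← Fin.coeSucc_eq_succ]
      have h1 := h.forward s.castSucc
      split_ifs at h1 with h2
      · rw [← h.attached_true _ h2, ← h1]
        exact Perm.sameCycle_apply_right.2 (Perm.sameCycle_apply_right.2
          (Perm.SameCycle.refl _ _))
      · rw [← h1]
        exact Perm.sameCycle_apply_right.2 (Perm.SameCycle.refl _ _)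
  have hM : ∀ s, ρ.SameCycle (M 0) (M s) := by
    intro s
    induction s using Fin.induction with
    | zero => exact Perm.SameCycle.refl _ _
    | succ s ih =>
      refine ih.trans ?_
      rw [← Fin.coeSucc_eq_succ]
      have h1 := h.backward s.castSucc
      split_ifs at h1 with h2
      · rw [← h.attached_false _ h2, ← h1]
        exact Perm.sameCycle_apply_left.2 (Perm.sameCycle_apply_left.2
          (Perm.SameCycle.refl _ _))
      · rw [← h1]
        exact Perm.sameCycle_apply_left.2 (Perm.SameCycle.refl _ _)
  have := cycleCount_le_card (σ := ρ)
    (Sum.elim (fun b : Bool => if b then P 0 else M 0) f) (by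
      intro ω
      rcases hf ω with ⟨s, rfl⟩ | ⟨s, rfl⟩ | ⟨s, hs, rfl⟩ | ⟨k, rfl⟩
      · exact ⟨Sum.inl true, hP s⟩
      · exact ⟨Sum.inl false, hM s⟩
      · rcases hb : side s with _ | _ | _
        · exact absurd hb hs
        · refine ⟨Sum.inl false, (hM s).trans ?_⟩
          rw [← h.attached_false s hb]
          exact Perm.sameCycle_apply_left.2 (Perm.SameCycle.refl _ _)
        · refine ⟨Sum.inl true, (hP s).trans ?_⟩
          rw [← h.attached_true s hb]
          exact Perm.sameCycle_apply_left.2 (Perm.SameCycle.refl _ _)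
      · exact ⟨Sum.inr k, Perm.SameCycle.refl _ _⟩)
  simpa [Nat.card_sum] using this

/-- Of any five chords that join vertices of the five triples at least one does not add a face. -/
theorem cycleCount_mul_chords_le [Finite Ω] [DecidableEq Ω] (h : IsCircleSystem ρ P M X side)
    (o : Fin 5 → Fin 3) (hlow : ∀ k, side (cycleTriple k (lowEnd (o k))) ≠ none)
    (hhigh : ∀ k, side (cycleTriple k (highEnd (o k))) ≠ none) :
    cycleCount (ρ * ((List.finRange 5).map fun k => swap (X (cycleTriple k (lowEnd (o k))))
      (X (cycleTriple k (highEnd (o k))))).prod) ≤ cycleCount ρ + 3 := by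
  set w : Fin 5 → Perm Ω := fun k => swap (X (cycleTriple k (lowEnd (o k))))
    (X (cycleTriple k (highEnd (o k)))) with hw
  have hcomm : ∀ k l, Commute (w k) (w l) := by
    intro k l
    by_cases hkl : k = l
    · rw [hkl]
    · refine Perm.Disjoint.commute fun ω => ?_
      by_contra! hcon
      have h1 := swap_apply_ne_self_iff.1 hcon.1
      have h2 := swap_apply_ne_self_iff.1 hcon.2
      rcases h1.2 with h3 | h3 <;> rcases h2.2 with h4 | h4 <;>
        exact hkl (cycleTriple_injective _ _ _ _ (h.injective (h3.symm.trans h4))).1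
  have hperm : ∀ l : List (Fin 5), l.Perm (List.finRange 5) →
      ((List.finRange 5).map w).prod = (l.map w).prod := by
    intro l hl
    refine (List.Perm.prod_eq' (hl.map w) ?_).symm
    rw [List.pairwise_map]
    exact List.pairwise_of_forall fun k l => hcomm k l
  have hlist : ∀ (σ : Perm Ω) (l : List (Fin 5)),
      cycleCount (σ * (l.map w).prod) ≤ cycleCount σ + l.length := by
    intro σ l
    have := cycleCount_mul_prod_swap_le σ (l.map fun k =>
      (X (cycleTriple k (lowEnd (o k))), X (cycleTriple k (highEnd (o k)))))
    rwa [List.map_map, List.length_map] at this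
  by_cases hmix : ∃ k, side (cycleTriple k (lowEnd (o k))) ≠ side (cycleTriple k (highEnd (o k)))
  · obtain ⟨k, hk⟩ := hmix
    rw [hperm _ (List.perm_cons_erase (List.mem_finRange k)).symm, List.map_cons, List.prod_cons,
      ← mul_assoc]
    have h1 : ¬ ρ.SameCycle (X (cycleTriple k (lowEnd (o k))))
        (X (cycleTriple k (highEnd (o k)))) := by
      have h2 := hlow k
      have h3 := hhigh k
      rcases h4 : side (cycleTriple k (lowEnd (o k))) with _ | _ | _ <;>
        rcases h5 : side (cycleTriple k (highEnd (o k))) with _ | _ | _ <;>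
        simp only [h4, h5, ne_eq, not_true_eq_false] at hk h2 h3
      · exact fun hc => h.not_sameCycle_of_sides h5 h4 hc.symm
      · exact h.not_sameCycle_of_sides h4 h5
    have h2 := cycleCount_mul_swap_add_one_le h1
    have h3 := hlist (ρ * w k) ((List.finRange 5).erase k)
    rw [List.length_erase_of_mem (List.mem_finRange k), List.length_finRange] at h3
    have h4 : cycleCount (ρ * w k) + 1 ≤ cycleCount ρ := h2
    omega
  · push Not at hmix
    obtain ⟨k, l, hkl, h1, h2, h3⟩ := exists_chordsCross o fun k =>
      side (cycleTriple k (lowEnd (o k))) = some true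
    have hne : l ≠ k := by rintro rfl; exact absurd h1 (lt_irrefl _)
    have hl : l ∈ (List.finRange 5).erase k :=
      (List.mem_erase_of_ne hne).2 (List.mem_finRange l)
    rw [hperm _ ((List.perm_cons_erase hl).symm.cons k |>.trans
      (List.perm_cons_erase (List.mem_finRange k)).symm), List.map_cons, List.prod_cons,
      List.map_cons, List.prod_cons, ← mul_assoc, ← mul_assoc]
    have h4 : ¬ (ρ * w k).SameCycle (X (cycleTriple l (lowEnd (o l))))
        (X (cycleTriple l (highEnd (o l)))) := by
      have h5 := hmix k
      have h6 := hlow k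
      have h7 := hlow l
      rcases h8 : side (cycleTriple k (lowEnd (o k))) with _ | _ | _ <;>
        rcases h9 : side (cycleTriple l (lowEnd (o l))) with _ | _ | _ <;>
        simp [h8, h9] at hkl h6 h7
      · exact h.not_sameCycle_of_cross_false h1 h2 h3 h8 (h5 ▸ h8) h9
      · exact h.not_sameCycle_of_cross_true h1 h2 h3 h8 (h5 ▸ h8) h9
    have h5 : cycleCount (ρ * w k * w l) + 1 ≤ cycleCount (ρ * w k) :=
      cycleCount_mul_swap_add_one_le h4
    have h6 : cycleCount (ρ * w k) ≤ cycleCount ρ + 1 := cycleCount_mul_swap_le _ _ _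
    have h7 := hlist (ρ * w k * w l) (((List.finRange 5).erase k).erase l)
    rw [List.length_erase_of_mem hl, List.length_erase_of_mem (List.mem_finRange k),
      List.length_finRange] at h7
    omega

end IsCircleSystem

theorem gadgetAction_chordSwap {K : Type*} [DecidableEq K] {n : ℕ} (o : Fin n → Fin 3) :
    (gadgetAction fun i => chordSwap (o i) : Perm (K ⊕ Fin n × GadgetDart)) =
      ((List.finRange n).map fun k => swap (.inr (k, .inl (lowEnd (o k))))
        (.inr (k, .inl (highEnd (o k))))).prod := by
  have key : ∀ l : List (Fin n), l.Nodup →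
      (gadgetAction fun i => if i ∈ l then chordSwap (o i) else 1 : Perm (K ⊕ Fin n × GadgetDart)) =
      (l.map fun k => swap (.inr (k, .inl (lowEnd (o k))))
        (.inr (k, .inl (highEnd (o k))))).prod := by
    intro l hl
    induction l using List.reverseRecOn with
    | nil => ext1 ω; rcases ω with k | ⟨i, γ⟩ <;> simp
    | append_singleton l a ih =>
      rw [← List.concat_eq_append, List.nodup_concat] at hl
      set f : Fin n → Perm GadgetDart := fun i => if i ∈ l then chordSwap (o i) else 1 with hf
      have h1 : (fun i => if i ∈ l ++ [a] then chordSwap (o i) else 1) =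
          Function.update f a (1 * chordSwap (o a)) := by
        funext i
        by_cases h : i = a
        · subst h; simp
        · simp [hf, h]
      have h2 : Function.update f a 1 = f := by
        rw [Function.update_eq_self_iff]
        simp [hf, hl.1]
      rw [h1, chordSwap, gadgetAction_update_mul_swap, h2, ih hl.2, List.map_append,
        List.prod_append]
      simp
  have := key (List.finRange n) (List.nodup_finRange n)
  simpa using this

/-- A permutation that moves all three darts at a vertex rotates them one way or the other. -/
theorem rotation_at_vertex {Ω W : Type*} {src : Ω → W} {ν : Perm Ω}
    (hsrc : ∀ ω, src (ν ω) = src ω) {p m x : Ω}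
    (hfib : ∀ ω, src ω = src p → ω = p ∨ ω = m ∨ ω = x) (hm : src m = src p)
    (hx : src x = src p) (hνp : ν p ≠ p) (hνm : ν m ≠ m) (hνx : ν x ≠ x)
    (hpm : p ≠ m) (hpx : p ≠ x) (hmx : m ≠ x) :
    (ν m = x ∧ ν x = p ∧ ν p = m) ∨ (ν m = p ∧ ν p = x ∧ ν x = m) := by
  have h1 := (hfib (ν p) (hsrc p)).resolve_left hνp
  have h2 := hfib (ν m) ((hsrc m).trans hm)
  have h3 := hfib (ν x) ((hsrc x).trans hx)
  have i1 : ν p ≠ ν m := ν.injective.ne hpm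
  have i2 : ν p ≠ ν x := ν.injective.ne hpx
  have i3 : ν m ≠ ν x := ν.injective.ne hmx
  rcases h1 with h1 | h1 <;> rcases h2 with h2 | h2 | h2 <;> rcases h3 with h3 | h3 | h3 <;>
    simp_all

/-- The place of a vertex within its triple. -/
def triplePosition (s : Fin 15) : Fin 3 := ⟨s.val / 5, by omega⟩

/-- The triple to which a vertex belongs. -/
def tripleIndex (s : Fin 15) : Fin 5 := ⟨s.val % 5, by omega⟩

theorem triplePosition_cycleTriple : ∀ i j, triplePosition (cycleTriple i j) = j := by
  decide

theorem tripleIndex_cycleTriple : ∀ i j, tripleIndex (cycleTriple i j) = i := by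
  decide

theorem cycleTriple_tripleIndex : ∀ s, cycleTriple (tripleIndex s) (triplePosition s) = s := by
  decide

/-- The neighbour of a vertex of the cycle in the direction given by `b`. -/
def cycleStep (s : Fin 15) (b : Bool) : Fin 15 := if b then s + 1 else s - 1

theorem graphG6_adj_iff : ∀ u v, graphG6.Adj u v ↔ ∃ b, cycleStep u b = v := by
  have : ∀ u v : Fin 15, (u - v = 1 ∨ v - u = 1) ↔ ∃ b, cycleStep u b = v := by decide
  exact this

/-- The darts of the cycle. -/
def cycleDart (p : Fin 15 × Bool) : graphG6.Dart :=
  ⟨(p.1, cycleStep p.1 p.2), (graphG6_adj_iff _ _).2 ⟨_, rfl⟩⟩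

theorem cycleDart_bijective : Function.Bijective cycleDart := by
  constructor
  · have : ∀ s b b', cycleStep s b = cycleStep s b' → b = b' := by decide
    rintro ⟨s, b⟩ ⟨s', b'⟩ h
    obtain rfl : s = s' := congrArg (fun d : graphG6.Dart => d.fst) h
    rw [this s b b' (congrArg (fun d : graphG6.Dart => d.snd) h)]
  · intro d
    obtain ⟨b, hb⟩ := (graphG6_adj_iff _ _).1 d.adj
    exact ⟨(d.fst, b), SimpleGraph.Dart.ext _ _ (Prod.ext rfl hb)⟩

theorem cycleStep_step (s : Fin 15) (b : Bool) : cycleStep (cycleStep s b) (!b) = s := by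
  cases b <;> simp [cycleStep]

theorem cycleDart_symm (s : Fin 15) (b : Bool) :
    (cycleDart (s, b)).symm = cycleDart (cycleStep s b, !b) :=
  SimpleGraph.Dart.ext _ _ (Prod.ext rfl (cycleStep_step s b).symm)

theorem graphG5_adj_iff : ∀ u v, graphG5.Adj u v ↔
    (∃ b, cycleStep u b = v) ∨ ∃ b : Bool, cycleTriple 0 (if b then 0 else 1) = u ∧
      cycleTriple 0 (if b then 1 else 0) = v := by
  intro u v
  rw [graphG5, SimpleGraph.sup_adj, graphG6_adj_iff, SimpleGraph.edge_adj]
  refine or_congr Iff.rfl ?_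
  revert u v
  decide

/-- The darts of the cycle with the added edge. -/
def thetaDart : Fin 15 × Bool ⊕ Bool → graphG5.Dart
  | .inl p => ⟨(p.1, cycleStep p.1 p.2), (graphG5_adj_iff _ _).2 (Or.inl ⟨_, rfl⟩)⟩
  | .inr b => ⟨(cycleTriple 0 (if b then 0 else 1), cycleTriple 0 (if b then 1 else 0)),
      (graphG5_adj_iff _ _).2 (Or.inr ⟨_, rfl, rfl⟩)⟩

theorem thetaDart_bijective : Function.Bijective thetaDart := by
  constructor
  · have h1 : ∀ s b b', cycleStep s b = cycleStep s b' → b = b' := by decide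
    have h2 : ∀ (s : Fin 15) (b b' : Bool), s = cycleTriple 0 (if b then 0 else 1) →
      cycleStep s b' ≠ cycleTriple 0 (if b then 1 else 0) := by decide
    have h3 : ∀ b b' : Bool, cycleTriple 0 (if b then 0 else 1) =
      cycleTriple 0 (if b' then 0 else 1) → b = b' := by decide
    rintro (⟨s, b⟩ | b) (⟨s', b'⟩ | b') h <;>
      have hf := congrArg (fun d : graphG5.Dart => d.fst) h <;>
      have hs := congrArg (fun d : graphG5.Dart => d.snd) h
    · obtain rfl : s = s' := hf
      rw [h1 s b b' hs]
    · exact absurd hs (h2 s b' b hf)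
    · exact absurd hs.symm (h2 s' b b' hf.symm)
    · rw [h3 b b' hf]
  · intro d
    rcases (graphG5_adj_iff _ _).1 d.adj with ⟨b, hb⟩ | ⟨b, hb, hb'⟩
    · exact ⟨.inl (d.fst, b), SimpleGraph.Dart.ext _ _ (Prod.ext rfl hb)⟩
    · exact ⟨.inr b, SimpleGraph.Dart.ext _ _ (Prod.ext hb hb')⟩

theorem thetaDart_symm_inl (s : Fin 15) (b : Bool) :
    (thetaDart (.inl (s, b))).symm = thetaDart (.inl (cycleStep s b, !b)) :=
  SimpleGraph.Dart.ext _ _ (Prod.ext rfl (cycleStep_step s b).symm)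

theorem thetaDart_symm_inr (b : Bool) : (thetaDart (.inr b)).symm = thetaDart (.inr !b) := by
  cases b <;> rfl

theorem finite_dart {V : Type*} [Finite V] (G : SimpleGraph V) : Finite G.Dart :=
  Finite.of_injective _ (SimpleGraph.Dart.toProd_injective (G := G))

theorem cycleCount_faceTracing_graphM6_le (R : RotationSystem graphM6) :
    cycleCount R.faceTracing ≤ 10 := by
  classical
  have := finite_dart graphG6
  obtain ⟨ν, o, hsrc, -, hmove, hle⟩ := exists_chords_of_rotationSystem cycleTriple R
  let P : Fin 15 → graphG6.Dart ⊕ Fin 5 × GadgetDart := fun s => .inl (cycleDart (s, true))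
  let M : Fin 15 → graphG6.Dart ⊕ Fin 5 × GadgetDart := fun s => .inl (cycleDart (s, false))
  let X : Fin 15 → graphG6.Dart ⊕ Fin 5 × GadgetDart := fun s =>
    .inr (tripleIndex s, .inl (triplePosition s))
  have hX : ∀ i j, X (cycleTriple i j) = .inr (i, .inl j) := fun i j => by
    simp only [X, tripleIndex_cycleTriple, triplePosition_cycleTriple]
  have hP1 : ∀ s, scaffoldSource cycleTriple (P s) = .inl s := fun s => rfl
  have hM1 : ∀ s, scaffoldSource cycleTriple (M s) = .inl s := fun s => rfl
  have hX1 : ∀ s, scaffoldSource cycleTriple (X s) = .inl s := fun s =>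
    congrArg Sum.inl (cycleTriple_tripleIndex s)
  have hPM : ∀ s, P s ≠ M s := fun s h => by
    have := cycleDart_bijective.1 (Sum.inl_injective h)
    simp at this
  have hPX : ∀ r s, P r ≠ X s := fun r s h => by simp [P, X] at h
  have hMX : ∀ r s, M r ≠ X s := fun r s h => by simp [M, X] at h
  have hcases : ∀ ω, (∃ s, ω = P s) ∨ (∃ s, ω = M s) ∨ (∃ s, ω = X s) ∨
      ∃ k : Fin 5 × (Fin 3 ⊕ Fin 2) × Fin 3, ω = .inr (k.1, .inr k.2) := by
    rintro (d | ⟨i, j | z⟩)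
    · obtain ⟨⟨s, b⟩, rfl⟩ := cycleDart_bijective.2 d
      cases b
      · exact Or.inr (Or.inl ⟨s, rfl⟩)
      · exact Or.inl ⟨s, rfl⟩
    · exact Or.inr (Or.inr (Or.inl ⟨cycleTriple i j, (hX i j).symm⟩))
    · exact Or.inr (Or.inr (Or.inr ⟨(i, z), rfl⟩))
  have hfib : ∀ s ω, scaffoldSource cycleTriple ω = .inl s → ω = P s ∨ ω = M s ∨ ω = X s := by
    intro s ω h
    rcases hcases ω with ⟨r, rfl⟩ | ⟨r, rfl⟩ | ⟨r, rfl⟩ | ⟨k, rfl⟩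
    · rw [hP1] at h; rw [Sum.inl_injective h]; simp
    · rw [hM1] at h; rw [Sum.inl_injective h]; simp
    · rw [hX1] at h; rw [Sum.inl_injective h]; simp
    · simp [scaffoldSource] at h
  have hrot : ∀ s, (ν (M s) = X s ∧ ν (X s) = P s ∧ ν (P s) = M s) ∨
      (ν (M s) = P s ∧ ν (P s) = X s ∧ ν (X s) = M s) := fun s =>
    rotation_at_vertex hsrc (hfib s) (hM1 s) (hX1 s)
      (hmove _ (M s) (by rw [hP1, hM1]) (hPM s) (by simp [P]))
      (hmove _ (P s) (by rw [hP1, hM1]) (hPM s).symm (by simp [M]))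
      (hmove _ (P s) (by rw [hP1, hX1]) (hPX s s).symm (by simp [X]))
      (hPM s) (hPX s s) (hMX s s)
  have hXinj : Function.Injective X := fun s s' h => by
    have := (hX1 s).symm.trans ((congrArg _ h).trans (hX1 s'))
    exact Sum.inl_injective this
  have hrevP : ∀ s, baseReversal graphG6 (Fin 5) (P s) = M (s + 1) := fun s =>
    congrArg Sum.inl (cycleDart_symm s true)
  have hrevM : ∀ s, baseReversal graphG6 (Fin 5) (M (s + 1)) = P s := fun s => by
    refine (congrArg Sum.inl (cycleDart_symm (s + 1) false)).trans ?_
    simp [cycleStep, P]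
  have hrevX : ∀ s, baseReversal graphG6 (Fin 5) (X s) = X s := fun s => rfl
  have hsys : IsCircleSystem (ν * baseReversal graphG6 (Fin 5)) P M X
      (fun s => some (decide (ν (M s) = X s))) := by
    refine ⟨fun s => ?_, fun s => ?_, fun s => ?_, fun s => ?_, hPX, hMX, hXinj⟩
    · rw [Perm.mul_apply, hrevP]
      rcases hrot (s + 1) with h | h <;> simp [h, hPX]
    · rw [Perm.mul_apply, hrevM]
      rcases hrot s with h | h <;> simp [h, hPX]
    · rw [Perm.mul_apply, hrevX]
      rcases hrot s with h | h <;> simp [h, hPX]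
    · rw [Perm.mul_apply, hrevX]
      rcases hrot s with h | h <;> simp [h]
  have h1 := hsys.cycleCount_le (fun k : Fin 5 × (Fin 3 ⊕ Fin 2) × Fin 3 => .inr (k.1, .inr k.2))
    fun ω => by simpa using hcases ω
  have h2 := hsys.cycleCount_mul_chords_le o (fun _ => by simp) (fun _ => by simp)
  rw [gadgetAction_chordSwap] at hle
  simp only [hX] at h2
  simp only [Nat.card_eq_fintype_card, Fintype.card_prod, Fintype.card_sum,
    Fintype.card_fin] at h1 hle
  have h3 : cycleCount R.faceTracing + 14 * 5 ≤ cycleCount _ := hle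
  omega

theorem cycleCount_faceTracing_graphM5_le (R : RotationSystem graphM5) :
    cycleCount R.faceTracing ≤ 9 := by
  classical
  have := finite_dart graphG5
  obtain ⟨ν, o, hsrc, -, hmove, hle⟩ :=
    exists_chords_of_rotationSystem (fun i : Fin 4 => cycleTriple i.succ) R
  let u : graphG5.Dart ⊕ Fin 4 × GadgetDart := .inl (thetaDart (.inr true))
  let v : graphG5.Dart ⊕ Fin 4 × GadgetDart := .inl (thetaDart (.inr false))
  let P : Fin 15 → graphG5.Dart ⊕ Fin 4 × GadgetDart := fun s => .inl (thetaDart (.inl (s, true)))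
  let M : Fin 15 → graphG5.Dart ⊕ Fin 4 × GadgetDart := fun s => .inl (thetaDart (.inl (s, false)))
  let X : Fin 15 → graphG5.Dart ⊕ Fin 4 × GadgetDart := fun s =>
    Fin.cases (![u, v, .inr (0, .inr (.inl 0, 0))] (triplePosition s))
      (fun i => .inr (i, .inl (triplePosition s))) (tripleIndex s)
  have hX : ∀ i j, X (cycleTriple (Fin.succ i) j) = .inr (i, .inl j) := fun i j => by
    simp only [X, tripleIndex_cycleTriple, triplePosition_cycleTriple, Fin.cases_succ]
  have hX0 : X 0 = u := rfl
  have hX5 : X 5 = v := rfl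
  have hX10 : X 10 = .inr (0, .inr (.inl 0, 0)) := rfl
  have hsite : ∀ s : Fin 15, s = 0 ∨ s = 5 ∨ s = 10 ∨ ∃ i j, s = cycleTriple (Fin.succ i) j := by
    decide
  have hne10 : ∀ i j, cycleTriple (Fin.succ i) j ≠ 10 := by decide
  have hP1 : ∀ s, scaffoldSource (fun i : Fin 4 => cycleTriple i.succ) (P s) = .inl s :=
    fun s => rfl
  have hM1 : ∀ s, scaffoldSource (fun i : Fin 4 => cycleTriple i.succ) (M s) = .inl s :=
    fun s => rfl
  have hX1 : ∀ s, s ≠ 10 →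
      scaffoldSource (fun i : Fin 4 => cycleTriple i.succ) (X s) = .inl s := by
    intro s hs
    rcases hsite s with rfl | rfl | rfl | ⟨i, j, rfl⟩
    · rfl
    · rfl
    · exact absurd rfl hs
    · rw [hX]; rfl
  have hPM : ∀ s, P s ≠ M s := fun s h => by
    have := thetaDart_bijective.1 (Sum.inl_injective h)
    simp at this
  have hXin : ∀ s, s ≠ 10 → ∀ i z, X s ≠ .inr (i, .inr z) := by
    intro s hs
    rcases hsite s with rfl | rfl | rfl | ⟨i, j, rfl⟩
    · simp [hX0, u]
    · simp [hX5, v]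
    · exact absurd rfl hs
    · simp [hX]
  have hdX : ∀ p s, (.inl (thetaDart (.inl p)) : graphG5.Dart ⊕ Fin 4 × GadgetDart) ≠ X s := by
    intro p s h
    rcases hsite s with rfl | rfl | rfl | ⟨i, j, rfl⟩
    · have := thetaDart_bijective.1 (Sum.inl_injective h)
      simp at this
    · have := thetaDart_bijective.1 (Sum.inl_injective h)
      simp at this
    · rw [hX10] at h; simp at h
    · rw [hX] at h; simp at h
  have hPX : ∀ r s, P r ≠ X s := fun r s => hdX _ s
  have hMX : ∀ r s, M r ≠ X s := fun r s => hdX _ s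
  have hcases : ∀ ω, (∃ s, ω = P s) ∨ (∃ s, ω = M s) ∨ (∃ s, s ≠ 10 ∧ ω = X s) ∨
      ∃ k : Fin 4 × (Fin 3 ⊕ Fin 2) × Fin 3, ω = .inr (k.1, .inr k.2) := by
    rintro (d | ⟨i, j | z⟩)
    · obtain ⟨⟨s, b⟩ | b, rfl⟩ := thetaDart_bijective.2 d
      · cases b
        · exact Or.inr (Or.inl ⟨s, rfl⟩)
        · exact Or.inl ⟨s, rfl⟩
      · cases b
        · exact Or.inr (Or.inr (Or.inl ⟨5, by decide, rfl⟩))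
        · exact Or.inr (Or.inr (Or.inl ⟨0, by decide, rfl⟩))
    · exact Or.inr (Or.inr (Or.inl ⟨cycleTriple i.succ j, hne10 i j, (hX i j).symm⟩))
    · exact Or.inr (Or.inr (Or.inr ⟨(i, z), rfl⟩))
  have hfib : ∀ s ω, scaffoldSource (fun i : Fin 4 => cycleTriple i.succ) ω = .inl s →
      ω = P s ∨ ω = M s ∨ (s ≠ 10 ∧ ω = X s) := by
    intro s ω h
    rcases hcases ω with ⟨r, rfl⟩ | ⟨r, rfl⟩ | ⟨r, hr, rfl⟩ | ⟨k, rfl⟩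
    · rw [hP1] at h; rw [Sum.inl_injective h]; simp
    · rw [hM1] at h; rw [Sum.inl_injective h]; simp
    · rw [hX1 r hr] at h; rw [← Sum.inl_injective h]; simp [hr]
    · simp [scaffoldSource] at h
  have hνP : ∀ s, ν (P s) ≠ P s := fun s =>
    hmove _ (M s) (by rw [hP1, hM1]) (hPM s) (by simp [P])
  have hνM : ∀ s, ν (M s) ≠ M s := fun s =>
    hmove _ (P s) (by rw [hP1, hM1]) (hPM s).symm (by simp [M])
  have hrot : ∀ s, s ≠ 10 → (ν (M s) = X s ∧ ν (X s) = P s ∧ ν (P s) = M s) ∨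
      (ν (M s) = P s ∧ ν (P s) = X s ∧ ν (X s) = M s) := fun s hs =>
    rotation_at_vertex hsrc (fun ω hω => (hfib s ω hω).imp id (Or.imp id And.right)) (hM1 s)
      (hX1 s hs) (hνP s) (hνM s)
      (hmove _ (P s) (by rw [hP1, hX1 s hs]) (hPX s s).symm (hXin s hs))
      (hPM s) (hPX s s) (hMX s s)
  have hrot10 : ν (M 10) = P 10 ∧ ν (P 10) = M 10 := by
    constructor
    · rcases hfib 10 _ (hsrc (M 10)) with h | h | h
      · exact h
      · exact absurd h (hνM 10)
      · exact absurd rfl h.1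
    · rcases hfib 10 _ (hsrc (P 10)) with h | h | h
      · exact absurd h (hνP 10)
      · exact h
      · exact absurd rfl h.1
  have hXinj : Function.Injective X := fun s s' h => by
    by_cases hs : s = 10
    · by_cases hs' : s' = 10
      · rw [hs, hs']
      · rw [hs, hX10] at h; exact absurd h.symm (hXin s' hs' _ _)
    · by_cases hs' : s' = 10
      · rw [hs', hX10] at h; exact absurd h (hXin s hs _ _)
      · exact Sum.inl_injective ((hX1 s hs).symm.trans ((congrArg _ h).trans (hX1 s' hs')))
  have hrevP : ∀ s, baseReversal graphG5 (Fin 4) (P s) = M (s + 1) := fun s =>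
    congrArg Sum.inl (thetaDart_symm_inl s true)
  have hrevM : ∀ s, baseReversal graphG5 (Fin 4) (M (s + 1)) = P s := fun s => by
    refine (congrArg Sum.inl (thetaDart_symm_inl (s + 1) false)).trans ?_
    simp [cycleStep, P]
  set ρ := ν * baseReversal graphG5 (Fin 4) * swap u v with hρ
  have hswap : ∀ ω, ω ≠ u → ω ≠ v → swap u v ω = ω := fun _ => swap_apply_of_ne_of_ne
  have hρP : ∀ s, ρ (P s) = ν (M (s + 1)) := fun s => by
    rw [hρ, Perm.mul_apply, hswap _ (hPX s 0) (hPX s 5), Perm.mul_apply, hrevP]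
  have hρM : ∀ s, ρ (M (s + 1)) = ν (P s) := fun s => by
    rw [hρ, Perm.mul_apply, hswap _ (hMX _ 0) (hMX _ 5), Perm.mul_apply, hrevM]
  have hρX : ∀ s, ρ (X s) = ν (X s) := fun s => by
    rw [hρ, Perm.mul_apply, Perm.mul_apply]
    congr 1
    rcases hsite s with rfl | rfl | rfl | ⟨i, j, rfl⟩
    · rw [hX0, swap_apply_left]
      exact congrArg Sum.inl (thetaDart_symm_inr false)
    · rw [hX5, swap_apply_right]
      exact congrArg Sum.inl (thetaDart_symm_inr true)
    · rw [hX10]; rfl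
    · rw [hX]; rfl
  have hsys : IsCircleSystem ρ P M X
      (fun s => if s = 10 then none else some (decide (ν (M s) = X s))) := by
    refine ⟨fun s => ?_, fun s => ?_, fun s => ?_, fun s => ?_, hPX, hMX, hXinj⟩
    · rw [hρP]
      by_cases hs : s + 1 = 10
      · rw [hs]; simp [hrot10]
      · rcases hrot (s + 1) hs with h | h <;> simp [h, hPX, hs]
    · rw [hρM]
      by_cases hs : s = 10
      · rw [hs]; simp [hrot10]
      · rcases hrot s hs with h | h <;> simp [h, hPX, hs]
    · rw [hρX]
      by_cases hs : s = 10
      · simp [hs]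
      · rcases hrot s hs with h | h <;> simp [h, hPX, hs]
    · rw [hρX]
      by_cases hs : s = 10
      · simp [hs]
      · rcases hrot s hs with h | h <;> simp [h, hs]
  have h1 := hsys.cycleCount_le (fun k : Fin 4 × (Fin 3 ⊕ Fin 2) × Fin 3 => .inr (k.1, .inr k.2))
    fun ω => by simpa using hcases ω
  have hside : ∀ s, s ≠ 10 →
      (if s = 10 then none else some (decide (ν (M s) = X s))) ≠ none := by
    intro s hs
    simp [hs]
  have h2 := hsys.cycleCount_mul_chords_le (Fin.cases 2 o)
    (fun k => hside _ (by
      refine Fin.cases ?_ (fun i => hne10 i _) k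
      change cycleTriple 0 (lowEnd 2) ≠ 10
      decide))
    (fun k => hside _ (by
      refine Fin.cases ?_ (fun i => hne10 i _) k
      change cycleTriple 0 (highEnd 2) ≠ 10
      decide))
  rw [gadgetAction_chordSwap] at hle
  rw [List.finRange_succ, List.map_cons, List.prod_cons, List.map_map, ← mul_assoc] at h2
  have h4 : ρ * swap (X (cycleTriple 0 (lowEnd 2))) (X (cycleTriple 0 (highEnd 2))) =
      ν * baseReversal graphG5 (Fin 4) := by
    change ρ * swap u v = _
    rw [hρ, mul_assoc, swap_mul_self, mul_one]
  simp only [Fin.cases_zero, Function.comp_def, Fin.cases_succ, hX, h4] at h2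
  simp only [Nat.card_eq_fintype_card, Fintype.card_prod, Fintype.card_sum,
    Fintype.card_fin] at h1 hle
  have h3 : cycleCount R.faceTracing + 14 * 4 ≤ cycleCount _ := hle
  omega

section Genus

variable {V : Type*} {G : SimpleGraph V}

theorem card_connectedComponent_of_connected (h : G.Connected) :
    Nat.card G.ConnectedComponent = 1 := by
  have := h.nonempty
  have : Subsingleton G.ConnectedComponent := h.preconnected.subsingleton_connectedComponent
  exact Nat.card_of_subsingleton (G.connectedComponentMk (Classical.arbitrary V))

theorem numFaces_eq_cycleCount [Nontrivial V] (h : G.Connected) (R : RotationSystem G) :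
    R.numFaces = cycleCount R.faceTracing := by
  have : IsEmpty {v : V // ∀ w, ¬ G.Adj v w} := ⟨fun ⟨v, hv⟩ => by
    obtain ⟨w, hw⟩ := h.preconnected.exists_adj_of_nontrivial v
    exact hv w hw⟩
  rw [RotationSystem.numFaces, Nat.card_of_isEmpty (α := {v : V // ∀ w, ¬ G.Adj v w}), add_zero]
  rfl

theorem graphGenus_eq_of_faces [Nontrivial V] (h : G.Connected) {f k : ℕ}
    (hle : ∀ R : RotationSystem G, cycleCount R.faceTracing ≤ f) (R : RotationSystem G)
    (hR : f ≤ cycleCount R.faceTracing)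
    (heuler : (Nat.card V : ℤ) - (Nat.card G.edgeSet : ℤ) + (f : ℤ) = 2 - 2 * (k : ℤ)) :
    graphGenus G = k := by
  have hcard := card_connectedComponent_of_connected h
  refine IsLeast.csInf_eq ⟨⟨R, ?_⟩, ?_⟩
  · rw [numFaces_eq_cycleCount h, (hle R).antisymm hR, hcard, heuler]
    norm_num
  · rintro k' ⟨R', hR'⟩
    rw [numFaces_eq_cycleCount h, hcard] at hR'
    have := hle R'
    omega

theorem two_mul_card_edgeSet [Finite V] (G : SimpleGraph V) :
    2 * Nat.card G.edgeSet = Nat.card G.Dart := by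
  classical
  have := Fintype.ofFinite V
  rw [Nat.card_eq_fintype_card, Nat.card_eq_fintype_card, G.dart_card_eq_twice_card_edges,
    SimpleGraph.edgeFinset_card]

/-- A rotation system given by a permutation of names of the darts. -/
def RotationSystem.ofEquiv {D : Type*} (e : D ≃ G.Dart) (N : Perm D)
    (h1 : ∀ d, (e (N d)).fst = (e d).fst)
    (h2 : ∀ d d', (e d).fst = (e d').fst → N.SameCycle d d') : RotationSystem G where
  next := e.permCongrHom N
  next_fst d := by
    obtain ⟨d, rfl⟩ := e.surjective d
    simpa using h1 d
  isCyclic d d' h := by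
    obtain ⟨d, rfl⟩ := e.surjective d
    obtain ⟨d', rfl⟩ := e.surjective d'
    obtain ⟨n, rfl⟩ := h2 d d' h
    refine ⟨n, ?_⟩
    rw [← map_zpow]
    simp

end Genus

/-- A rotation system with at least `n` faces from a permutation of names of the darts and an
invariant labelling with `n` labels. -/
theorem exists_rotationSystem_of_faces {V D : Type*} [Finite V] {G : SimpleGraph V}
    {e : D ≃ G.Dart} {source : D → V} (hsource : ∀ d, (e d).fst = source d) {r : D → D}
    (hr : ∀ d, (e d).symm = e (r d)) {N : Perm D} (h1 : ∀ d, source (N d) = source d)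
    (h2 : ∀ d d', source d = source d' → d' = d ∨ d' = N d ∨ d' = N (N d)) {n : ℕ}
    {face : D → Fin n} (hface : Function.Surjective face) (h3 : ∀ d, face (N (r d)) = face d) :
    ∃ R : RotationSystem G, n ≤ cycleCount R.faceTracing := by
  have := finite_dart G
  have h4 : ∀ d d', (e d).fst = (e d').fst → N.SameCycle d d' := by
    intro d d' h
    rw [hsource, hsource] at h
    rcases h2 d d' h with rfl | rfl | rfl
    · exact Perm.SameCycle.refl _ _
    · exact Perm.sameCycle_apply_right.2 (Perm.SameCycle.refl _ _)
    · exact Perm.sameCycle_apply_right.2 (Perm.sameCycle_apply_right.2 (Perm.SameCycle.refl _ _))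
  let R : RotationSystem G := .ofEquiv e N (fun d => by rw [hsource, hsource, h1]) h4
  have hR : ∀ d, R.faceTracing (e d) = e (N (r d)) := fun d => by
    change (e.permCongrHom N) (e d).symm = _
    rw [hr]
    simp
  have h5 := card_le_cycleCount (σ := R.faceTracing) (face ∘ e.symm)
    (hface.comp e.symm.surjective) fun a => by
      obtain ⟨d, rfl⟩ := e.surjective a
      rw [hR]
      simpa using h3 d
  rw [Nat.card_eq_fintype_card, Fintype.card_fin] at h5
  exact ⟨R, h5⟩

/-- Names for the darts of `M₆`. -/
abbrev DartM6 := Fin 15 × Bool ⊕ Fin 5 × GadgetDart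

/-- Names for the darts of `M₅`. -/
abbrev DartM5 := (Fin 15 × Bool ⊕ Bool) ⊕ Fin 4 × GadgetDart

/-- The darts of `M₆` by their names. -/
noncomputable def dartEquivM6 : DartM6 ≃ graphM6.Dart :=
  (Equiv.sumCongr (Equiv.ofBijective _ cycleDart_bijective) (Equiv.refl _)).trans
    (scaffoldDartEquiv cycleTriple)

/-- The darts of `M₅` by their names. -/
noncomputable def dartEquivM5 : DartM5 ≃ graphM5.Dart :=
  (Equiv.sumCongr (Equiv.ofBijective _ thetaDart_bijective) (Equiv.refl _)).trans
    (scaffoldDartEquiv fun i : Fin 4 => cycleTriple i.succ)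

/-- The initial vertices of the darts of `M₆`. -/
def sourceM6 : DartM6 → ScaffoldVertex (Fin 15) (Fin 5)
  | .inl p => .inl p.1
  | .inr (i, .inl j) => .inl (cycleTriple i j)
  | .inr (i, .inr (w, _)) => .inr (i, w)

/-- The initial vertices of the darts of `M₅`. -/
def sourceM5 : DartM5 → ScaffoldVertex (Fin 15) (Fin 4)
  | .inl (.inl p) => .inl p.1
  | .inl (.inr b) => .inl (cycleTriple 0 (if b then 0 else 1))
  | .inr (i, .inl j) => .inl (cycleTriple i.succ j)
  | .inr (i, .inr (w, _)) => .inr (i, w)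

/-- The reversal of the darts of `M₆`. -/
def reversalM6 : DartM6 → DartM6 :=
  Sum.map (fun p => (cycleStep p.1 p.2, !p.2)) (Prod.map id gadgetReversal)

/-- The reversal of the darts of `M₅`. -/
def reversalM5 : DartM5 → DartM5 :=
  Sum.map (Sum.map (fun p => (cycleStep p.1 p.2, !p.2)) not) (Prod.map id gadgetReversal)

theorem dartEquivM6_fst (d : DartM6) : (dartEquivM6 d).fst = sourceM6 d := by
  rcases d with p | ⟨i, j | z⟩ <;> rfl

theorem dartEquivM5_fst (d : DartM5) : (dartEquivM5 d).fst = sourceM5 d := by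
  rcases d with (p | b) | ⟨i, j | z⟩ <;> rfl

theorem dartEquivM6_symm (d : DartM6) : (dartEquivM6 d).symm = dartEquivM6 (reversalM6 d) := by
  refine (scaffoldDart_symm cycleTriple _).trans (congrArg _ ?_)
  rcases d with ⟨s, b⟩ | ⟨i, γ⟩
  · exact congrArg Sum.inl (cycleDart_symm s b)
  · rfl

theorem dartEquivM5_symm (d : DartM5) : (dartEquivM5 d).symm = dartEquivM5 (reversalM5 d) := by
  refine (scaffoldDart_symm (fun i : Fin 4 => cycleTriple i.succ) _).trans (congrArg _ ?_)
  rcases d with (⟨s, b⟩ | b) | ⟨i, γ⟩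
  · exact congrArg Sum.inl (thetaDart_symm_inl s b)
  · exact congrArg Sum.inl (thetaDart_symm_inr b)
  · rfl

/-- The rotation of the inner darts of a copy of `H₃` that is used for the embeddings below. -/
def innerStep (w : Fin 3 ⊕ Fin 2) : Fin 3 :=
  if w = .inl 2 ∨ w = .inr 1 then 1 else 2

/-- The rotations of an embedding of `M₆` of genus `6`. -/
def rotateM6 : DartM6 → DartM6
  | .inl (s, true) =>
    if 10 ≤ s then .inl (s, false) else .inr (tripleIndex s, .inl (triplePosition s))
  | .inl (s, false) =>
    if 10 ≤ s then .inr (tripleIndex s, .inl (triplePosition s)) else .inl (s, true)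
  | .inr (i, .inl j) => .inl (cycleTriple i j, decide (j = 2))
  | .inr (i, .inr (w, k)) => .inr (i, .inr (w, k + innerStep w))

/-- The dart of `M₅` that leaves the cycle at a given vertex, if there is one. -/
def attachedM5 (s : Fin 15) : DartM5 :=
  Fin.cases (![.inl (.inr true), .inl (.inr false), .inl (.inl (s, true))] (triplePosition s))
    (fun i => .inr (i, .inl (triplePosition s))) (tripleIndex s)

/-- The rotations of an embedding of `M₅` of genus `5`. -/
def rotateM5 : DartM5 → DartM5
  | .inl (.inl (s, true)) => if 10 ≤ s then .inl (.inl (s, false)) else attachedM5 s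
  | .inl (.inl (s, false)) => if 10 ≤ s then attachedM5 s else .inl (.inl (s, true))
  | .inl (.inr b) => .inl (.inl (cycleTriple 0 (if b then 0 else 1), false))
  | .inr (i, .inl j) => .inl (.inl (cycleTriple i.succ j, decide (j = 2)))
  | .inr (i, .inr (w, k)) => .inr (i, .inr (w, k + innerStep w))

set_option synthInstance.maxHeartbeats 400000 in
set_option synthInstance.maxSize 1000 in
/-- The rotations of the embedding of `M₆`, as a permutation. -/
def rotationPermM6 : Perm DartM6 where
  toFun := rotateM6
  invFun d := rotateM6 (rotateM6 d)
  left_inv := by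
    unfold Function.LeftInverse
    decide +kernel
  right_inv := by
    unfold Function.RightInverse Function.LeftInverse
    decide +kernel

set_option synthInstance.maxHeartbeats 400000 in
set_option synthInstance.maxSize 1000 in
/-- The rotations of the embedding of `M₅`, as a permutation. -/
def rotationPermM5 : Perm DartM5 where
  toFun := rotateM5
  invFun := rotateM5^[5]
  left_inv := by
    unfold Function.LeftInverse
    decide +kernel
  right_inv := by
    unfold Function.RightInverse Function.LeftInverse
    decide +kernel

theorem sourceM6_rotate : ∀ d, sourceM6 (rotateM6 d) = sourceM6 d := by
  decide +kernel

theorem sourceM5_rotate : ∀ d, sourceM5 (rotateM5 d) = sourceM5 d := by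
  decide +kernel

set_option synthInstance.maxHeartbeats 400000 in
set_option synthInstance.maxSize 1000 in
theorem eq_rotate_of_sourceM6 : ∀ d d', sourceM6 d = sourceM6 d' →
    d' = d ∨ d' = rotateM6 d ∨ d' = rotateM6 (rotateM6 d) := by
  decide +kernel

set_option synthInstance.maxHeartbeats 400000 in
set_option synthInstance.maxSize 1000 in
theorem eq_rotate_of_sourceM5 : ∀ d d', sourceM5 d = sourceM5 d' →
    d' = d ∨ d' = rotateM5 d ∨ d' = rotateM5 (rotateM5 d) := by
  decide +kernel

/-- The face to the side of a dart, for the embedding of `M₆`. -/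
def faceM6 : DartM6 → Fin 10
  | .inl (s, true) => ![0, 0, 0, 0, 0, 0, 0, 0, 0, 0, 1, 2, 3, 4, 0] s
  | .inl (s, false) => ![0, 0, 0, 0, 0, 0, 1, 2, 3, 4, 0, 0, 0, 0, 0] s
  | .inr (i, .inl j) => ![![0, 1, 0], ![0, 2, 1], ![0, 3, 2], ![0, 4, 3], ![0, 0, 4]] i j
  | .inr (i, .inr (.inl j, k)) =>
    ![![![0, 5, 0], ![0, 0, 1], ![1, 0, 5]], ![![0, 6, 0], ![1, 0, 2], ![2, 1, 6]],
      ![![0, 7, 0], ![2, 0, 3], ![3, 2, 7]], ![![0, 8, 0], ![3, 0, 4], ![4, 3, 8]],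
      ![![0, 9, 0], ![4, 0, 0], ![0, 4, 9]]] i j k
  | .inr (i, .inr (.inr p, k)) =>
    ![![![0, 0, 5], ![5, 0, 1]], ![![0, 1, 6], ![6, 0, 2]], ![![0, 2, 7], ![7, 0, 3]],
      ![![0, 3, 8], ![8, 0, 4]], ![![0, 4, 9], ![9, 0, 0]]] i p k

/-- The face to the side of a dart, for the embedding of `M₅`. -/
def faceM5 : DartM5 → Fin 9
  | .inl (.inl (s, true)) => ![0, 0, 0, 0, 0, 0, 0, 0, 0, 0, 0, 2, 3, 4, 0] s
  | .inl (.inl (s, false)) => ![0, 1, 1, 1, 1, 1, 0, 2, 3, 4, 0, 0, 0, 0, 0] s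
  | .inl (.inr b) => if b then 1 else 0
  | .inr (i, .inl j) => ![![1, 2, 0], ![1, 3, 2], ![1, 4, 3], ![1, 0, 4]] i j
  | .inr (i, .inr (.inl j, k)) =>
    ![![![1, 5, 1], ![0, 1, 2], ![2, 0, 5]], ![![1, 6, 1], ![2, 1, 3], ![3, 2, 6]],
      ![![1, 7, 1], ![3, 1, 4], ![4, 3, 7]], ![![1, 8, 1], ![4, 1, 0], ![0, 4, 8]]] i j k
  | .inr (i, .inr (.inr p, k)) =>
    ![![![1, 0, 5], ![5, 1, 2]], ![![1, 2, 6], ![6, 1, 3]], ![![1, 3, 7], ![7, 1, 4]],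
      ![![1, 4, 8], ![8, 1, 0]]] i p k

theorem faceM6_invariant : ∀ d, faceM6 (rotateM6 (reversalM6 d)) = faceM6 d := by
  decide +kernel

theorem faceM5_invariant : ∀ d, faceM5 (rotateM5 (reversalM5 d)) = faceM5 d := by
  decide +kernel

theorem faceM6_surjective : Function.Surjective faceM6 := by
  unfold Function.Surjective
  decide +kernel

theorem faceM5_surjective : Function.Surjective faceM5 := by
  unfold Function.Surjective
  decide +kernel

theorem exists_rotationSystem_graphM6 :
    ∃ R : RotationSystem graphM6, 10 ≤ cycleCount R.faceTracing :=
  exists_rotationSystem_of_faces dartEquivM6_fst dartEquivM6_symm (N := rotationPermM6)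
    sourceM6_rotate eq_rotate_of_sourceM6 faceM6_surjective faceM6_invariant

theorem exists_rotationSystem_graphM5 :
    ∃ R : RotationSystem graphM5, 9 ≤ cycleCount R.faceTracing :=
  exists_rotationSystem_of_faces dartEquivM5_fst dartEquivM5_symm (N := rotationPermM5)
    sourceM5_rotate eq_rotate_of_sourceM5 faceM5_surjective faceM5_invariant

theorem scaffoldedGraph_connected {V ι : Type*} {G : SimpleGraph V} (t : ι → Fin 3 ↪ V)
    (h : G.Connected) : (scaffoldedGraph G t).Connected := by
  have := h.nonempty
  let f : G →g scaffoldedGraph G t := ⟨Sum.inl, fun h => scaffoldedGraph_adj_inl t h⟩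
  have hV : ∀ u v : V, (scaffoldedGraph G t).Reachable (.inl u) (.inl v) := fun u v =>
    (h.preconnected u v).map f
  have hmid : ∀ i j v, (scaffoldedGraph G t).Reachable (.inr (i, .inl j)) (.inl v) := fun i j v =>
    (scaffoldedGraph_adj_map t i (H3_adj_free_mid j)).symm.reachable.trans (hV _ v)
  have hall : ∀ x v, (scaffoldedGraph G t).Reachable x (.inl v) := by
    rintro (u | ⟨i, j | p⟩) v
    · exact hV u v
    · exact hmid i j v
    · exact (scaffoldedGraph_adj_map t i (H3_adj_mid_pole 0 p)).symm.reachable.trans (hmid i 0 v)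
  let v := Classical.arbitrary V
  exact ⟨fun x y => (hall x v).trans (hall y v).symm⟩

theorem graphG6_connected : graphG6.Connected := SimpleGraph.cycleGraph_connected

theorem graphM6_connected : graphM6.Connected := scaffoldedGraph_connected _ graphG6_connected

theorem graphM5_connected : graphM5.Connected :=
  scaffoldedGraph_connected _ (graphG6_connected.mono le_sup_left)

theorem card_edgeSet_graphM6 : Nat.card graphM6.edgeSet = 60 := by
  have h := two_mul_card_edgeSet graphM6
  rw [← Nat.card_congr dartEquivM6, Nat.card_eq_fintype_card (α := DartM6)] at h
  simp only [Fintype.card_sum, Fintype.card_prod, Fintype.card_fin, Fintype.card_bool] at h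
  omega

theorem card_edgeSet_graphM5 : Nat.card graphM5.edgeSet = 52 := by
  have h := two_mul_card_edgeSet graphM5
  rw [← Nat.card_congr dartEquivM5, Nat.card_eq_fintype_card (α := DartM5)] at h
  simp only [Fintype.card_sum, Fintype.card_prod, Fintype.card_fin, Fintype.card_bool] at h
  omega

theorem card_scaffoldVertex_five : Nat.card (ScaffoldVertex (Fin 15) (Fin 5)) = 40 := by
  simp

theorem card_scaffoldVertex_four : Nat.card (ScaffoldVertex (Fin 15) (Fin 4)) = 35 := by
  simp

/-- A dart of `M₆` that leaves a given vertex. -/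
def dartAtM6 : ScaffoldVertex (Fin 15) (Fin 5) → DartM6
  | .inl s => .inl (s, true)
  | .inr (i, w) => .inr (i, .inr (w, 0))

theorem sourceM6_dartAt : ∀ v, sourceM6 (dartAtM6 v) = v := by
  decide +kernel

/-- The terminal vertices of the darts of `M₆`. -/
def targetM6 (d : DartM6) : ScaffoldVertex (Fin 15) (Fin 5) := sourceM6 (reversalM6 d)

theorem targetM6_pairwise_ne : ∀ v,
    targetM6 (dartAtM6 v) ≠ targetM6 (rotateM6 (dartAtM6 v)) ∧
    targetM6 (dartAtM6 v) ≠ targetM6 (rotateM6 (rotateM6 (dartAtM6 v))) ∧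
    targetM6 (rotateM6 (dartAtM6 v)) ≠ targetM6 (rotateM6 (rotateM6 (dartAtM6 v))) := by
  decide +kernel

theorem graphM6_adj_iff (v w : ScaffoldVertex (Fin 15) (Fin 5)) :
    graphM6.Adj v w ↔ ∃ d, sourceM6 d = v ∧ targetM6 d = w := by
  have hsnd : ∀ d, (dartEquivM6 d).snd = targetM6 d := fun d => by
    rw [targetM6, ← dartEquivM6_fst, ← dartEquivM6_symm]
    rfl
  constructor
  · intro h
    obtain ⟨d, hd⟩ := dartEquivM6.surjective ⟨(v, w), h⟩
    refine ⟨d, ?_, ?_⟩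
    · rw [← dartEquivM6_fst, hd]
    · rw [← hsnd, hd]
  · rintro ⟨d, rfl, rfl⟩
    rw [← dartEquivM6_fst, ← hsnd]
    exact (dartEquivM6 d).adj

theorem ncard_neighborSet_graphM6 (v : ScaffoldVertex (Fin 15) (Fin 5)) :
    (graphM6.neighborSet v).ncard = 3 := by
  have hv := sourceM6_dartAt v
  obtain ⟨h1, h2, h3⟩ := targetM6_pairwise_ne v
  rw [Set.ncard_eq_three]
  refine ⟨_, _, _, h1, h2, h3, ?_⟩
  ext w
  rw [SimpleGraph.mem_neighborSet, graphM6_adj_iff]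
  constructor
  · rintro ⟨d, hd, rfl⟩
    rcases eq_rotate_of_sourceM6 (dartAtM6 v) d (hv.trans hd.symm) with rfl | rfl | rfl <;> simp
  · rintro (rfl | rfl | rfl)
    · exact ⟨_, hv, rfl⟩
    · exact ⟨_, by rw [sourceM6_rotate, hv], rfl⟩
    · exact ⟨_, by rw [sourceM6_rotate, sourceM6_rotate, hv], rfl⟩

theorem graphGenus_graphM6 : graphGenus graphM6 = 6 := by
  obtain ⟨R, hR⟩ := exists_rotationSystem_graphM6
  have : Nontrivial (ScaffoldVertex (Fin 15) (Fin 5)) := Sum.inl_injective.nontrivial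
  refine graphGenus_eq_of_faces graphM6_connected cycleCount_faceTracing_graphM6_le R hR ?_
  rw [card_scaffoldVertex_five, card_edgeSet_graphM6]
  norm_num

theorem graphGenus_graphM5 : graphGenus graphM5 = 5 := by
  obtain ⟨R, hR⟩ := exists_rotationSystem_graphM5
  have : Nontrivial (ScaffoldVertex (Fin 15) (Fin 4)) := Sum.inl_injective.nontrivial
  refine graphGenus_eq_of_faces graphM5_connected cycleCount_faceTracing_graphM5_le R hR ?_
  rw [card_scaffoldVertex_four, card_edgeSet_graphM5]
  norm_num

theorem bettiNumber_graphM6 : bettiNumber graphM6 = 21 := by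
  rw [bettiNumber, card_scaffoldVertex_five, card_edgeSet_graphM6,
    card_connectedComponent_of_connected graphM6_connected]
  norm_num

theorem bettiNumber_graphM5 : bettiNumber graphM5 = 18 := by
  rw [bettiNumber, card_scaffoldVertex_four, card_edgeSet_graphM5,
    card_connectedComponent_of_connected graphM5_connected]
  norm_num

theorem mainTheorem5 :
    (Nat.card (ScaffoldVertex (Fin 15) (Fin 5)) = 40 ∧
      (∀ v, (graphM6.neighborSet v).ncard = 3) ∧
      graphGenus graphM6 = 6 ∧ bettiNumber graphM6 = 21 ∧ ¬ SatisfiesDuke graphM6) ∧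
    (graphGenus graphM5 = 5 ∧ bettiNumber graphM5 = 18 ∧ ¬ SatisfiesDuke graphM5) := by
  refine ⟨⟨card_scaffoldVertex_five, ncard_neighborSet_graphM6, graphGenus_graphM6,
    bettiNumber_graphM6, ?_⟩, graphGenus_graphM5, bettiNumber_graphM5, ?_⟩
  · rw [SatisfiesDuke, bettiNumber_graphM6, graphGenus_graphM6]
    norm_num
  · rw [SatisfiesDuke, bettiNumber_graphM5, graphGenus_graphM5]
    norm_num
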